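/- Let $\alpha_1,\alpha_2\in(0,1)$ with $\alpha_1+\alpha_2\ge 1$, let $q\in\mathbb R\setminus\{0\}$ and $k\in\{0,1\}$. **Function space.** Let $\mathcal S=\mathcal S^{(\alpha_2,\alpha_1)}_{(\alpha_1,\alpha_2)}(2)$ be the space of restrictions to $\mathbb R^2$ of the entire functions $\varphi$ on $\mathbb C^2$ for which there are $a_1,a_2,b_1,b_2,C>0$ with $$|\varphi(x+iy)|\le C\exp\bigl(-a_1|x_1|^{1/\alpha_1}-a_2|x_2|^{1/\alpha_2}+b_1|y_1|^{1/(1-\alpha_2)}+b_2|y_2|^{1/(1-\alpha_1)}\bigr)\qquad(x,y\in\mathbb R^2).$$ **Weyl product.** Let $\omega(x,y)=x_1y_2-x_2y_1$, $S\mathcal F(u)(y)=\int_{\mathbb R^2}e^{i\omega(x,y)}u(x)\,dx$, $(u\times_q v)(x)=\int_{\mathbb R^2}e^{iq\omega(x,y)}u(y)v(x-y)\,dy$, and $u\star^W_q v=S\mathcal F[S\mathcal F(u)\times_q S\mathcal F(v)]$. **Twisting.** Let $\phi(z)=\frac{e^{ik\pi/2}}{q}\sinh(iqz)$, which is injective on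 the strip $S_q=\{z\in\mathbb C:|\operatorname{Re}z|<\frac{\pi}{2|q|}\}$, and let $\phi^{-1}:\phi(S_q)\to S_q$ be its inverse. Let $\Gamma\subset\mathbb R$ be a nonempty open interval with $\Gamma+i\mathbb R\subset\phi(S_q)$ (that is, $\Gamma\subset(0,\infty)$ or $\Gamma\subset(-\infty,0)$ if $k=0$, and $\Gamma\subset(-\frac1{|q|},\frac1{|q|})$ if $k=1$). Write $\mathcal L(u)(z)=\int_{\mathbb R}e^{-zx}u(x)\,dx$ and $\mathcal L^{-1}F(x)=\frac1{2\pi i}\int_{c+i\mathbb R}e^{zx}F(z)\,dz$ with $c\in\Gamma$. Define $\tau=\tau_q^{(k)}$ on $\mathcal S$ by letting $\mathcal L^{-1}\circ(\phi^{-1})^*\circ\mathcal L$ act on the second variable: $$(\tau f)(x_1,\cdot)=\mathcal L^{-1}\bigl(\mathcal L(f(x_1,\cdot))\circ\phi^{-1}\bigr)\qquad(x_1\in\mathbb R).$$ **Proposition.** The map $\tau$ does not depend on the choice of $c\in\Gamma$. It is linear and injective with values in $C^\infty(\mathbb R^2)=C^\infty(\mathbb R^2,\mathbb C)$. Let $E=E^{(k)}_{(\alpha_1,\alpha_2)}=\tau(\mathcal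 S)$ be its range and $T=T^{(k)}_q:E\to\mathcal S$ its inverse, a linear isomorphism. Then $T=\mathrm{id}_{x_1}\otimes(\mathcal L^{-1}\circ\phi^*\circ\mathcal L)_{x_2}$ in the following sense: for $u\in E$, $x_1\in\mathbb R$ and $z\in S_q$ with $\operatorname{Re}\phi(z)\in\Gamma$, the Laplace integral of $u(x_1,\cdot)$ at $\phi(z)$ converges absolutely and $$\mathcal L\bigl((Tu)(x_1,\cdot)\bigr)(z)=\mathcal L\bigl(u(x_1,\cdot)\bigr)(\phi(z)).$$ The space $\mathcal S$ contains $Tu\star^W_q Tv$ for all $u,v\in E$, and the formula $$u\star^{(k)}_q v:=\tau\bigl(Tu\star^W_q Tv\bigr)\qquad(u,v\in E)$$ defines an associative $\mathbb R$-algebra structure on $E$: $\star^{(k)}_q$ maps $E\times E$ to $E$, is $\mathbb R$-bilinear and is associative. -/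

import Mathlib

open MeasureTheory
open scoped ContDiff

noncomputable section

namespace TwistedWeyl

/-- The Gelfand-Shilov estimate: `φ` is an entire function on `ℂ^m` and there are
`a, b ∈ (0,∞)^m`, `C > 0` with
`|φ(x+iy)| ≤ C exp(∑ⱼ (-aⱼ|xⱼ|^(1/αⱼ) + bⱼ|yⱼ|^(1/(1-βⱼ))))`. -/
def IsGelfandShilov {m : ℕ} (α β : Fin m → ℝ) (φ : (Fin m → ℂ) → ℂ) : Prop :=
  Differentiable ℂ φ ∧ ∃ a b : Fin m → ℝ, ∃ C : ℝ, (∀ j, 0 < a j) ∧ (∀ j, 0 < b j) ∧ 0 < C ∧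
    ∀ z : Fin m → ℂ, ‖φ z‖ ≤ C * Real.exp
      (∑ j, (-(a j) * |(z j).re| ^ (1 / α j) + b j * |(z j).im| ^ (1 / (1 - β j))))

theorem IsGelfandShilov.add {m : ℕ} {α β : Fin m → ℝ} {φ ψ : (Fin m → ℂ) → ℂ}
    (hφ : IsGelfandShilov α β φ) (hψ : IsGelfandShilov α β ψ) :
    IsGelfandShilov α β (fun z => φ z + ψ z) := by
  obtain ⟨hd, a, b, C, ha, hb, hC, h⟩ := hφ
  obtain ⟨hd', a', b', C', ha', hb', hC', h'⟩ := hψ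
  refine ⟨hd.add hd', fun j => min (a j) (a' j), fun j => max (b j) (b' j), C + C',
    fun j => lt_min (ha j) (ha' j), fun j => lt_max_of_lt_left (hb j), by positivity, ?_⟩
  intro z
  refine (norm_add_le _ _).trans ?_
  rw [add_mul]
  refine add_le_add ((h z).trans ?_) ((h' z).trans ?_)
  · gcongr with j
    · exact min_le_left _ _
    · exact le_max_left _ _
  · gcongr with j
    · exact min_le_right _ _
    · exact le_max_right _ _

theorem IsGelfandShilov.smul {m : ℕ} {α β : Fin m → ℝ} {φ : (Fin m → ℂ) → ℂ} (r : ℝ)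
    (hφ : IsGelfandShilov α β φ) : IsGelfandShilov α β (fun z => r • φ z) := by
  obtain ⟨hd, a, b, C, ha, hb, hC, h⟩ := hφ
  refine ⟨hd.const_smul r, a, b, (|r| + 1) * C, ha, hb, by positivity, fun z => ?_⟩
  rw [norm_smul, Real.norm_eq_abs, mul_assoc]
  exact mul_le_mul (by linarith) (h z) (norm_nonneg _) (by positivity)

theorem IsGelfandShilov.zero {m : ℕ} (α β : Fin m → ℝ) :
    IsGelfandShilov α β (fun _ => 0) :=
  ⟨differentiable_const _, fun _ => 1, fun _ => 1, 1, fun _ => one_pos, fun _ => one_pos, one_pos,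
    fun z => by rw [norm_zero]; positivity⟩

/-- The Gelfand-Shilov space `S_α^β(m)`, viewed as a space of functions on `ℝ^m`
(restrictions of the entire functions satisfying the estimate). -/
def gelfandShilov {m : ℕ} (α β : Fin m → ℝ) : Submodule ℝ ((Fin m → ℝ) → ℂ) where
  carrier := {f | ∃ φ : (Fin m → ℂ) → ℂ, IsGelfandShilov α β φ ∧
    ∀ x : Fin m → ℝ, f x = φ (fun j => (x j : ℂ))}
  add_mem' := by
    rintro f g ⟨φ, hφ, hf⟩ ⟨ψ, hψ, hg⟩
    exact ⟨_, hφ.add hψ, fun x => by rw [Pi.add_apply, hf, hg]⟩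
  zero_mem' := ⟨_, IsGelfandShilov.zero α β, fun _ => rfl⟩
  smul_mem' := by
    rintro r f ⟨φ, hφ, hf⟩
    exact ⟨_, hφ.smul r, fun x => by rw [Pi.smul_apply, hf]⟩

/-- The space `S_{(α₁,α₂)}^{(α₂,α₁)}(2)`. -/
def symmetricSpace (α₁ α₂ : ℝ) : Submodule ℝ ((Fin 2 → ℝ) → ℂ) :=
  gelfandShilov ![α₁, α₂] ![α₂, α₁]

/-- The symplectic form `ω(x,y) = x₁y₂ - x₂y₁` on `ℝ²`. -/
def omega (x y : Fin 2 → ℝ) : ℝ := x 0 * y 1 - x 1 * y 0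

/-- The symplectic Fourier transform `SF(u)(y) = ∫ e^{iω(x,y)} u(x) dx`. -/
def symplecticFourier (u : (Fin 2 → ℝ) → ℂ) (y : Fin 2 → ℝ) : ℂ :=
  ∫ x : Fin 2 → ℝ, Complex.exp (Complex.I * (omega x y : ℂ)) * u x

/-- The twisted convolution `(u ×_q v)(x) = ∫ e^{iqω(x,y)} u(y) v(x-y) dy`. -/
def twistedConv (q : ℝ) (u v : (Fin 2 → ℝ) → ℂ) (x : Fin 2 → ℝ) : ℂ :=
  ∫ y : Fin 2 → ℝ, Complex.exp (Complex.I * (q : ℂ) * (omega x y : ℂ)) * (u y * v (x - y))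

/-- The Weyl product `u ⋆_q^W v = SF[SF(u) ×_q SF(v)]`. -/
def weyl (q : ℝ) (u v : (Fin 2 → ℝ) → ℂ) : (Fin 2 → ℝ) → ℂ :=
  symplecticFourier (twistedConv q (symplecticFourier u) (symplecticFourier v))

/-- The (bilateral) Laplace transform `L(u)(z) = ∫ e^{-zx} u(x) dx`. -/
def laplace (u : ℝ → ℂ) (z : ℂ) : ℂ :=
  ∫ x : ℝ, Complex.exp (-z * (x : ℂ)) * u x

/-- The inverse Laplace transform along the line `Re z = c`:
`(2πi)⁻¹ ∫_{c+iℝ} e^{zx} F(z) dz = (2π)⁻¹ ∫_ℝ e^{(c+it)x} F(c+it) dt`. -/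
def invLaplace (c : ℝ) (F : ℂ → ℂ) (x : ℝ) : ℂ :=
  (2 * Real.pi : ℂ)⁻¹ * ∫ t : ℝ,
    Complex.exp (((c : ℂ) + (t : ℂ) * Complex.I) * (x : ℂ)) * F ((c : ℂ) + (t : ℂ) * Complex.I)

/-- The twisting map `φ_{q,θ}(z) = (e^{iθ}/q) sinh(iqz)` for `q ≠ 0`, and `φ_{0,θ}(z) = z`. -/
def twist (q θ : ℝ) (z : ℂ) : ℂ :=
  if q = 0 then z
  else Complex.exp (Complex.I * (θ : ℂ)) / (q : ℂ) * Complex.sinh (Complex.I * (q : ℂ) * z)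

/-- The strip `|Re z| < π/(2|q|)`, on which the twisting map (`q ≠ 0`) is injective. -/
def strip (q : ℝ) : Set ℂ := {z | |z.re| < Real.pi / (2 * |q|)}

/-- The inverse of the twisting map, with values in the strip. -/
def twistInv (q θ : ℝ) : ℂ → ℂ := Function.invFunOn (twist q θ) (strip q)

/-- The angle `kπ/2`. -/
def angle (k : Fin 2) : ℝ := ((k : ℕ) : ℝ) * (Real.pi / 2)

/-- `Γ` is a nonempty open interval such that the inverse twisting map is defined on the
vertical strip `Γ + iℝ`. -/
def IsAdmissible (q θ : ℝ) (Γ : Set ℝ) : Prop :=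
  Γ.Nonempty ∧ IsOpen Γ ∧ Γ.OrdConnected ∧ ∀ z : ℂ, z.re ∈ Γ → z ∈ twist q θ '' strip q

/-- `τ_q^{(k)} = id ⊗ (L⁻¹ ∘ (φ_{q,kπ/2}⁻¹)^* ∘ L)`, the second factor acting on the second
variable, and `L⁻¹` being computed on the line `Re z = c`. -/
def tau (q : ℝ) (k : Fin 2) (c : ℝ) (f : (Fin 2 → ℝ) → ℂ) : (Fin 2 → ℝ) → ℂ := fun x =>
  invLaplace c (fun z => laplace (fun s => f ![x 0, s]) (twistInv q (angle k) z)) (x 1)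

end TwistedWeyl

end

noncomputable section

namespace TwistedWeyl

/-! ### Weights -/

/-! The symplectic form pairs `x₁` with `y₂` and `x₂` with `y₁`, and for variables paired in this
way the decay exponent `1/αⱼ` in the real direction of one and the growth exponent `1/(1-αⱼ)` in the
imaginary direction of the other are conjugate. Young's inequality therefore absorbs every factor
`exp(ω(Re, Im))` into the decay, and a contour shift optimised by the Legendre transform turns
growth in the imaginary directions into decay of the Fourier transform. So the space is stable under
the symplectic Fourier transform (`isSym_sfExt`) and under twisted convolution (`isSym_tcExt`). The
transform squares to `(2π)²` (`IsSym.sfExt_sfExt`), which reduces associativity of the Weyl product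
to that of twisted convolution, a cocycle identity for `ω` (`twistedConv_assoc`).

For `τ`, one-dimensional Fourier inversion expresses the partial Laplace transform at `w` through
the symplectic Fourier transform at the points `(-iw, y)`. Hence it is entire in `w` and is
`O(exp(-a|Im w|^(1/α₁)))` on vertical strips (`IsSym.exists_norm_laplace_le`). The twisting map
grows at most exponentially in `|Im w|`, so its inverse grows at least logarithmically; since `1/α₁
> 1`, composing with the inverse leaves decay faster than any power
(`exists_pow_mul_exp_twistInv_le`). This makes the inverse Laplace integral independent of the line
(`StripDecay.invLaplace_congr`), a right inverse of the Laplace transform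
(`StripDecay.laplace_invLaplace`) and smooth (`IsSym.contDiff_invLaplace`). Injectivity of `τ` is
the identity theorem for entire functions followed by Fourier inversion (`eq_zero_of_tau_eq_zero`).
The product is then transported from the symmetric space to the range of `τ`. -/

theorem holderConjugate_one_div {α : ℝ} (h : α ∈ Set.Ioo (0 : ℝ) 1) :
    (1 / α).HolderConjugate (1 / (1 - α)) := by
  have h1 := h.1
  have h2 := h.2
  rw [Real.holderConjugate_iff]
  refine ⟨by rw [lt_div_iff₀ h1]; linarith, ?_⟩
  simp

theorem abs_add_rpow_le {p : ℝ} (hp : 0 ≤ p) (x y : ℝ) :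
    |x + y| ^ p ≤ 2 ^ p * (|x| ^ p + |y| ^ p) := by
  have h : |x + y| ≤ 2 * max |x| |y| :=
    (abs_add_le x y).trans (by linarith [le_max_left |x| |y|, le_max_right |x| |y|])
  have hm : max |x| |y| ^ p ≤ |x| ^ p + |y| ^ p := by
    rcases max_choice |x| |y| with h | h <;> rw [h]
    · exact le_add_of_nonneg_right (by positivity)
    · exact le_add_of_nonneg_left (by positivity)
  calc |x + y| ^ p ≤ (2 * max |x| |y|) ^ p := Real.rpow_le_rpow (abs_nonneg _) h hp
    _ = 2 ^ p * max |x| |y| ^ p := Real.mul_rpow (by norm_num) (by positivity)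
    _ ≤ _ := by gcongr

/-- Young's inequality with a small coefficient: apply it to `δx` and `δ⁻¹y` with `δ^p = ε`. -/
theorem exists_mul_le_rpow {p p' : ℝ} (h : p.HolderConjugate p') {ε : ℝ} (hε : 0 < ε) :
    ∃ K, 0 < K ∧ ∀ x y : ℝ, 0 ≤ x → 0 ≤ y → x * y ≤ ε * x ^ p + K * y ^ p' := by
  have hp := h.lt
  have hp' := h.symm.lt
  set δ := ε ^ (1 / p)
  have hδ : 0 < δ := by positivity
  refine ⟨δ⁻¹ ^ p' / p', by positivity, fun x y hx hy => ?_⟩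
  have hy' := Real.young_inequality_of_nonneg (a := δ * x) (b := δ⁻¹ * y)
    (by positivity) (by positivity) h
  rw [Real.mul_rpow hδ.le hx, Real.mul_rpow (by positivity) hy] at hy'
  have h1 : δ ^ p = ε := by
    rw [← Real.rpow_mul hε.le, one_div, inv_mul_cancel₀ (by linarith), Real.rpow_one]
  have h2 : δ * x * (δ⁻¹ * y) = x * y := by field_simp
  rw [h1, h2] at hy'
  refine hy'.trans ?_
  gcongr ?_ + ?_
  · exact div_le_self (by positivity) hp.le
  · exact le_of_eq (by ring)

theorem exists_rpow_sub_mul_le {p p' : ℝ} (h : p.HolderConjugate p') {b : ℝ} (hb : 0 < b) :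
    ∃ a, 0 < a ∧ ∀ x : ℝ, 0 ≤ x → ∃ y, 0 ≤ y ∧ b * y ^ p' - x * y ≤ -a * x ^ p := by
  have hp := h.lt
  have hp' := h.symm.lt
  -- Chosen so that at `y = δ x^(p-1)` the term `b y^p'` is exactly half of `x y`, up to constants
  -- the optimum of the Legendre transform.
  set δ := (1 / (2 * b)) ^ (1 / (p' - 1))
  have hδ : 0 < δ := by positivity
  refine ⟨δ / 2, by positivity, fun x hx => ⟨δ * x ^ (p - 1), by positivity, ?_⟩⟩
  have h1 : δ ^ p' = δ * (1 / (2 * b)) := by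
    have : δ ^ (p' - 1) = 1 / (2 * b) := by
      rw [← Real.rpow_mul (by positivity), one_div_mul_cancel (by linarith), Real.rpow_one]
    rw [← this, Real.rpow_sub_one hδ.ne']
    field_simp
  have h2 : (x ^ (p - 1)) ^ p' = x ^ p := by
    rw [← Real.rpow_mul hx, h.sub_one_mul_conj]
  have h3 : x * x ^ (p - 1) = x ^ p := by
    rcases hx.eq_or_lt with rfl | hx
    · rw [zero_mul, Real.zero_rpow (by linarith)]
    · rw [Real.rpow_sub_one hx.ne']; field_simp
  rw [Real.mul_rpow hδ.le (by positivity), h1, h2, mul_left_comm x, h3]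
  apply le_of_eq
  field_simp
  ring

theorem exp_neg_rpow_le {p a : ℝ} (hp : 1 ≤ p) (ha : 0 < a) (n : ℕ) :
    ∃ C, 0 < C ∧ ∀ x : ℝ, (1 + |x|) ^ n * Real.exp (-a * |x| ^ p) ≤ C := by
  refine ⟨(2 / a) ^ n * n.factorial * Real.exp a, by positivity, fun x => ?_⟩
  have h1 : 1 + |x| ≤ 2 * (1 + |x| ^ p) := by
    have h0 : 0 ≤ |x| ^ p := by positivity
    rcases le_total |x| 1 with h | h
    · linarith
    · linarith [Real.self_le_rpow_of_one_le h hp]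
  have h2 := Real.pow_div_factorial_le_exp (a * (1 + |x| ^ p)) (by positivity) n
  rw [div_le_iff₀ (by positivity)] at h2
  calc (1 + |x|) ^ n * Real.exp (-a * |x| ^ p)
      ≤ (2 * (1 + |x| ^ p)) ^ n * Real.exp (-a * |x| ^ p) := by gcongr
    _ = (2 / a) ^ n * (a * (1 + |x| ^ p)) ^ n * Real.exp (-a * |x| ^ p) := by
        rw [← mul_pow]; congr 2; field_simp
    _ ≤ (2 / a) ^ n * (Real.exp (a * (1 + |x| ^ p)) * n.factorial) * Real.exp (-a * |x| ^ p) := by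
        gcongr
    _ = (2 / a) ^ n * n.factorial * (Real.exp (a * (1 + |x| ^ p)) * Real.exp (-a * |x| ^ p)) := by
        ring
    _ = _ := by rw [← Real.exp_add]; congr 2; ring

theorem integrable_of_pow_mul_le {f : ℝ → ℝ} (hf : AEStronglyMeasurable f) {C : ℝ}
    (h : ∀ x, (1 + |x|) ^ 2 * |f x| ≤ C) : Integrable f := by
  have hi : Integrable (fun x : ℝ => C * (1 + ‖x‖) ^ (-2 : ℝ)) :=
    (integrable_one_add_norm (by norm_num)).const_mul C
  refine hi.mono' hf (Filter.Eventually.of_forall fun x => ?_)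
  have h1 : 0 < 1 + |x| := by positivity
  rw [Real.norm_eq_abs, Real.norm_eq_abs, Real.rpow_neg h1.le, ← div_eq_mul_inv, le_div_iff₀
    (by positivity), mul_comm]
  simpa using h x

theorem integrable_pow_mul_exp_neg_rpow {p a : ℝ} (hp : 1 ≤ p) (ha : 0 < a) (n : ℕ) :
    Integrable (fun x : ℝ => (1 + |x|) ^ n * Real.exp (-a * |x| ^ p)) := by
  obtain ⟨C, -, hC⟩ := exp_neg_rpow_le hp ha (n + 2)
  refine integrable_of_pow_mul_le (C := C) ?_ fun x => ?_
  · have : Continuous fun x : ℝ => |x| ^ p := continuous_abs.rpow_const fun _ => Or.inr (by linarith)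
    exact Continuous.aestronglyMeasurable (by fun_prop)
  · rw [abs_of_nonneg (a := (1 + |x|) ^ n * _) (by positivity), ← mul_assoc, ← pow_add, add_comm 2 n]
    exact hC x

theorem integrable_exp_neg_rpow {p a : ℝ} (hp : 1 ≤ p) (ha : 0 < a) :
    Integrable (fun x : ℝ => Real.exp (-a * |x| ^ p)) := by
  simpa using integrable_pow_mul_exp_neg_rpow hp ha 0

/-- The anisotropic weight `|x₁|^(1/α₁) + |x₂|^(1/α₂)`. -/
def weight (α₁ α₂ : ℝ) (x : Fin 2 → ℝ) : ℝ := |x 0| ^ (1 / α₁) + |x 1| ^ (1 / α₂)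

section weight

variable {α₁ α₂ : ℝ}

theorem weight_nonneg (x : Fin 2 → ℝ) : 0 ≤ weight α₁ α₂ x := by
  unfold weight; positivity

theorem weight_neg (x : Fin 2 → ℝ) : weight α₁ α₂ (-x) = weight α₁ α₂ x := by
  simp [weight]

theorem continuous_weight (h₁ : 0 < α₁) (h₂ : 0 < α₂) : Continuous (weight α₁ α₂) :=
  ((continuous_abs.comp (continuous_apply 0)).rpow_const fun _ => Or.inr (by positivity)).add
    ((continuous_abs.comp (continuous_apply 1)).rpow_const fun _ => Or.inr (by positivity))

theorem exists_weight_add_le (h₁ : 0 < α₁) (h₂ : 0 < α₂) : ∃ A, 1 ≤ A ∧ ∀ x y : Fin 2 → ℝ,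
    weight α₁ α₂ (x + y) ≤ A * (weight α₁ α₂ x + weight α₁ α₂ y) := by
  have e1 : (1 : ℝ) ≤ 2 ^ (1 / α₁) := Real.one_le_rpow (by norm_num) (by positivity)
  refine ⟨2 ^ (1 / α₁) + 2 ^ (1 / α₂), ?_, fun x y => ?_⟩
  · have : (0 : ℝ) ≤ 2 ^ (1 / α₂) := by positivity
    linarith
  · have i1 := abs_add_rpow_le (p := 1 / α₁) (by positivity) (x 0) (y 0)
    have i2 := abs_add_rpow_le (p := 1 / α₂) (by positivity) (x 1) (y 1)
    simp only [weight, Pi.add_apply]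
    have q1 : 0 ≤ 2 ^ (1 / α₂) * (|x 0| ^ (1 / α₁) + |y 0| ^ (1 / α₁)) := by positivity
    have q2 : 0 ≤ 2 ^ (1 / α₁) * (|x 1| ^ (1 / α₂) + |y 1| ^ (1 / α₂)) := by positivity
    linarith

/-- The form crosses the two coordinates, so the weight dual to `(α₁, α₂)` is `(1 - α₂, 1 - α₁)`, in
swapped order; the bound is Young's inequality in each of the two products. -/
theorem exists_abs_omega_le (h₁ : α₁ ∈ Set.Ioo (0 : ℝ) 1) (h₂ : α₂ ∈ Set.Ioo (0 : ℝ) 1)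
    {ε : ℝ} (hε : 0 < ε) : ∃ K, 0 < K ∧ ∀ x y : Fin 2 → ℝ,
    |omega x y| ≤ ε * weight α₁ α₂ x + K * weight (1 - α₂) (1 - α₁) y := by
  obtain ⟨K₁, hK₁, H₁⟩ := exists_mul_le_rpow (holderConjugate_one_div h₁) hε
  obtain ⟨K₂, hK₂, H₂⟩ := exists_mul_le_rpow (holderConjugate_one_div h₂) hε
  refine ⟨K₁ + K₂, by positivity, fun x y => ?_⟩
  have i1 := H₁ |x 0| |y 1| (abs_nonneg _) (abs_nonneg _)
  have i2 := H₂ |x 1| |y 0| (abs_nonneg _) (abs_nonneg _)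
  have q1 : 0 ≤ K₂ * |y 1| ^ (1 / (1 - α₁)) := by positivity
  have q2 : 0 ≤ K₁ * |y 0| ^ (1 / (1 - α₂)) := by positivity
  have := abs_sub (x 0 * y 1) (x 1 * y 0)
  rw [abs_mul, abs_mul] at this
  simp only [weight, omega]
  linarith

/-- This is the Legendre transform of the growth weight; it selects the imaginary displacement of
the contour when the Fourier transform is estimated. -/
theorem exists_weight_add_omega_le (h₁ : α₁ ∈ Set.Ioo (0 : ℝ) 1) (h₂ : α₂ ∈ Set.Ioo (0 : ℝ) 1)
    {b : ℝ} (hb : 0 < b) : ∃ a, 0 < a ∧ ∀ x : Fin 2 → ℝ, ∃ y,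
    b * weight (1 - α₂) (1 - α₁) y + omega x y ≤ -a * weight α₁ α₂ x := by
  obtain ⟨a₁, ha₁, H₁⟩ := exists_rpow_sub_mul_le (holderConjugate_one_div h₁) hb
  obtain ⟨a₂, ha₂, H₂⟩ := exists_rpow_sub_mul_le (holderConjugate_one_div h₂) hb
  refine ⟨min a₁ a₂, lt_min ha₁ ha₂, fun x => ?_⟩
  have key : ∀ (s r : ℝ), 0 ≤ r → ∃ t : ℝ, |t| = r ∧ s * t = -(|s| * r) := fun s r hr => by
    rcases le_total 0 s with h | h
    · exact ⟨-r, by rw [abs_neg, abs_of_nonneg hr], by rw [abs_of_nonneg h]; ring⟩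
    · exact ⟨r, abs_of_nonneg hr, by rw [abs_of_nonpos h]; ring⟩
  obtain ⟨r₁, hr₁, i1⟩ := H₁ |x 0| (abs_nonneg _)
  obtain ⟨r₂, hr₂, i2⟩ := H₂ |x 1| (abs_nonneg _)
  obtain ⟨t₁, ht₁, e1⟩ := key (x 0) r₁ hr₁
  obtain ⟨t₂, ht₂, e2⟩ := key (-x 1) r₂ hr₂
  rw [abs_neg] at e2
  refine ⟨![t₂, t₁], ?_⟩
  have q1 : min a₁ a₂ * |x 0| ^ (1 / α₁) ≤ a₁ * |x 0| ^ (1 / α₁) := by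
    gcongr; exact min_le_left _ _
  have q2 : min a₁ a₂ * |x 1| ^ (1 / α₂) ≤ a₂ * |x 1| ^ (1 / α₂) := by
    gcongr; exact min_le_right _ _
  simp only [weight, omega, Matrix.cons_val_zero, Matrix.cons_val_one, ht₁, ht₂]
  linarith

theorem integrable_exp_neg_weight (h₁ : α₁ ∈ Set.Ioo (0 : ℝ) 1) (h₂ : α₂ ∈ Set.Ioo (0 : ℝ) 1)
    {a : ℝ} (ha : 0 < a) :
    Integrable (fun x : Fin 2 → ℝ => Real.exp (-a * weight α₁ α₂ x)) := by
  have := Integrable.fintype_prod (μ := fun _ : Fin 2 => (volume : Measure ℝ))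
    (f := ![fun x : ℝ => Real.exp (-a * |x| ^ (1 / α₁)),
      fun x : ℝ => Real.exp (-a * |x| ^ (1 / α₂))]) (𝕜 := ℝ)
    (Fin.forall_fin_two.2 ⟨integrable_exp_neg_rpow (holderConjugate_one_div h₁).lt.le ha,
      integrable_exp_neg_rpow (holderConjugate_one_div h₂).lt.le ha⟩)
  refine this.congr (Filter.Eventually.of_forall fun x => ?_)
  simp [Fin.prod_univ_two, weight, ← Real.exp_add]
  ring_nf

end weight

end TwistedWeyl

namespace TwistedWeyl

/-! ### Holomorphic parameter integrals -/

/-- Directional derivatives are limits of sequences of measurable difference quotients, and in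
finite dimension a basis reassembles the full derivative from them. -/
theorem aestronglyMeasurable_fderiv_of_forall_aestronglyMeasurable
    {E X : Type*} [NormedAddCommGroup E] [NormedSpace ℂ E]
    [FiniteDimensional ℂ E] [MeasurableSpace X] {μ : Measure X} {F : E → X → ℂ} {z : E}
    (hmeas : ∀ᶠ w in nhds z, AEStronglyMeasurable (F w) μ)
    (hd : ∀ x, DifferentiableAt ℂ (fun w => F w x) z) :
    AEStronglyMeasurable (fun x => fderiv ℂ (fun w => F w x) z) μ := by
  have hdir : ∀ v : E, AEStronglyMeasurable (fun x => fderiv ℂ (fun w => F w x) z v) μ := by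
    intro v
    have hlim : Filter.Tendsto (fun n : ℕ => z + ((n : ℂ) + 1)⁻¹ • v) Filter.atTop (nhds z) := by
      have : Filter.Tendsto (fun n : ℕ => ((n : ℂ) + 1)⁻¹) Filter.atTop (nhds 0) := by
        simpa using! tendsto_one_div_add_atTop_nhds_zero_nat (𝕜 := ℂ)
      simpa using (this.smul_const v).const_add z
    -- The sample points lie in the region of measurability only eventually, hence the index shift
    -- by `N`.
    obtain ⟨N, hN⟩ := Filter.eventually_atTop.1 (hlim.eventually hmeas)
    refine aestronglyMeasurable_of_tendsto_ae Filter.atTop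
      (f := fun n x => ((n + N : ℕ) + 1 : ℂ) • (F (z + (((n + N : ℕ) : ℂ) + 1)⁻¹ • v) x - F z x))
      (fun n => ?_) (Filter.Eventually.of_forall fun x => ?_)
    · exact ((hN (n + N) (by omega)).sub hmeas.self_of_nhds).const_smul ((n + N : ℕ) + 1 : ℂ)
    · have := (hd x).hasFDerivAt.lim v
        (c := fun n : ℕ => ((n + N : ℕ) + 1 : ℂ)) (l := Filter.atTop)
        (by
          have h0 : Filter.Tendsto (fun n : ℕ => ((n + N + 1 : ℕ) : ℝ)) Filter.atTop
              Filter.atTop :=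
            tendsto_natCast_atTop_atTop.comp ((Filter.tendsto_add_atTop_nat (N + 1)))
          refine h0.congr fun n => ?_
          rw [← Nat.cast_add_one, Complex.norm_natCast])
      exact this
  let b := Module.finBasis ℂ E
  have hsum : (fun x => fderiv ℂ (fun w => F w x) z) = fun x =>
      ∑ i, (fderiv ℂ (fun w => F w x) z (b i)) • (LinearMap.toContinuousLinearMap (b.coord i)) := by
    funext x
    ext v
    conv_lhs => rw [← b.sum_repr v, map_sum]
    simp [mul_comm]
  rw [hsum]
  exact Finset.aestronglyMeasurable_fun_sum _ fun i _ => (hdir _).smul_const _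

/-- For holomorphic integrands a dominating function for the values alone suffices: the Schwarz
lemma on a ball turns it into an integrable Lipschitz bound. -/
theorem differentiableAt_integral
    {E X : Type*} [NormedAddCommGroup E] [NormedSpace ℂ E]
    [FiniteDimensional ℂ E] [MeasurableSpace X] {μ : Measure X} {F : E → X → ℂ} {z : E} {s : Set E}
    (hs : s ∈ nhds z) (hmeas : ∀ w ∈ s, AEStronglyMeasurable (F w) μ)
    (hd : ∀ x, DifferentiableOn ℂ (fun w => F w x) s) {g : X → ℝ} (hg : Integrable g μ)
    (hb : ∀ w ∈ s, ∀ x, ‖F w x‖ ≤ g x) :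
    DifferentiableAt ℂ (fun w => ∫ x, F w x ∂μ) z := by
  obtain ⟨r, hr, hball⟩ := Metric.mem_nhds_iff.1 hs
  have hz := mem_of_mem_nhds hs
  refine (hasFDerivAt_integral_of_dominated_loc_of_lip' (𝕜 := ℂ) (Metric.ball_mem_nhds z hr)
    (F' := fun x => fderiv ℂ (fun w => F w x) z) (bound := fun x => 2 * g x / r)
    (fun w hw => hmeas w (hball hw)) (hg.mono' (hmeas z hz) (.of_forall (hb z hz))) ?_ ?_
    ((hg.const_mul 2).div_const r) (.of_forall fun x => ?_)).2.differentiableAt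
  · exact aestronglyMeasurable_fderiv_of_forall_aestronglyMeasurable
      (Filter.mem_of_superset hs hmeas) fun x => (hd x).differentiableAt hs
  · refine .of_forall fun x w hw => ?_
    have := Complex.dist_le_div_mul_dist_of_mapsTo_ball (R₂ := 2 * g x) ((hd x).mono hball)
      (fun v hv => ?_) hw
    · rwa [dist_eq_norm, dist_eq_norm] at this
    · rw [Metric.mem_closedBall, dist_eq_norm]
      exact (norm_sub_le _ _).trans (by linarith [hb v (hball hv) x, hb z hz x])
  · exact ((hd x).differentiableAt hs).hasFDerivAt

/-- A holomorphic function whose values do not change under small displacements in the directions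
of a set spanning the space over `ℂ` has derivative zero. -/
theorem fderiv_eq_zero_of_span {E : Type*} [NormedAddCommGroup E] [NormedSpace ℂ E]
    {f : E → ℂ} {z : E} (hf : DifferentiableAt ℂ f z) {S : Set E}
    (hS : Submodule.span ℂ S = ⊤)
    (h : ∀ v ∈ S, ∀ᶠ t : ℝ in nhds 0, f (z + (t : ℂ) • v) = f z) : fderiv ℂ f z = 0 := by
  ext v
  have hle : Submodule.span ℂ S ≤ LinearMap.ker (fderiv ℂ f z : E →ₗ[ℂ] ℂ) := by
    rw [Submodule.span_le]
    intro v hv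
    have h1 : HasDerivAt (fun t : ℝ => f (z + (t : ℂ) • v)) (fderiv ℂ f z v) 0 := by
      have h2 : HasDerivAt (fun t : ℝ => z + (t : ℂ) • v) v 0 := by
        simpa using ((Complex.ofRealCLM.hasDerivAt (x := 0)).smul_const v).const_add z
      have h3 : HasFDerivAt f (fderiv ℂ f z) (z + ((0 : ℝ) : ℂ) • v) := by
        simpa using hf.hasFDerivAt
      exact (h3.restrictScalars ℝ).comp_hasDerivAt (0 : ℝ) h2
    have h4 : HasDerivAt (fun t : ℝ => f (z + (t : ℂ) • v)) 0 0 :=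
      (hasDerivAt_const (0 : ℝ) (f z)).congr_of_eventuallyEq (h v hv)
    exact h1.unique h4
  rw [hS] at hle
  exact hle (Submodule.mem_top (x := v))

end TwistedWeyl

namespace TwistedWeyl

/-! ### Entire functions with symmetric Gelfand-Shilov bounds -/

/-- The inclusion of `ℝ²` into `ℂ²`. -/
def cvec (x : Fin 2 → ℝ) : Fin 2 → ℂ := fun j => (x j : ℂ)

/-- The real part of a vector. -/
def reVec (z : Fin 2 → ℂ) : Fin 2 → ℝ := fun j => (z j).re

/-- The imaginary part of a vector. -/
def imVec (z : Fin 2 → ℂ) : Fin 2 → ℝ := fun j => (z j).im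

/-- The complex bilinear extension of `omega`. -/
def omegaC (z w : Fin 2 → ℂ) : ℂ := z 0 * w 1 - z 1 * w 0

theorem continuous_cvec : Continuous cvec := by unfold cvec; fun_prop
theorem continuous_reVec : Continuous reVec := by unfold reVec; fun_prop
theorem continuous_imVec : Continuous imVec := by unfold imVec; fun_prop
theorem continuous_omega {X : Type*} [TopologicalSpace X] {f g : X → Fin 2 → ℝ}
    (hf : Continuous f) (hg : Continuous g) : Continuous fun x => omega (f x) (g x) := by
  unfold omega; fun_prop
theorem continuous_omegaC {X : Type*} [TopologicalSpace X] {f g : X → Fin 2 → ℂ}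
    (hf : Continuous f) (hg : Continuous g) : Continuous fun x => omegaC (f x) (g x) := by
  unfold omegaC; fun_prop
theorem differentiable_omegaC_left (w : Fin 2 → ℂ) : Differentiable ℂ fun z => omegaC z w := by
  unfold omegaC; fun_prop
theorem differentiable_omegaC_right (w : Fin 2 → ℂ) : Differentiable ℂ fun z => omegaC w z := by
  unfold omegaC; fun_prop

@[simp] theorem reVec_cvec (x : Fin 2 → ℝ) : reVec (cvec x) = x := by ext; simp [reVec, cvec]
@[simp] theorem imVec_cvec (x : Fin 2 → ℝ) : imVec (cvec x) = 0 := by ext; simp [imVec, cvec]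
@[simp] theorem reVec_add (z w : Fin 2 → ℂ) : reVec (z + w) = reVec z + reVec w := by
  ext; simp [reVec]
@[simp] theorem imVec_add (z w : Fin 2 → ℂ) : imVec (z + w) = imVec z + imVec w := by
  ext; simp [imVec]
@[simp] theorem reVec_sub (z w : Fin 2 → ℂ) : reVec (z - w) = reVec z - reVec w := by
  ext; simp [reVec]
@[simp] theorem imVec_sub (z w : Fin 2 → ℂ) : imVec (z - w) = imVec z - imVec w := by
  ext; simp [imVec]
@[simp] theorem reVec_I_smul_cvec (x : Fin 2 → ℝ) : reVec (Complex.I • cvec x) = 0 := by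
  ext; simp [reVec, cvec]
@[simp] theorem imVec_I_smul_cvec (x : Fin 2 → ℝ) : imVec (Complex.I • cvec x) = x := by
  ext; simp [imVec, cvec]
@[simp] theorem omega_zero_left (x : Fin 2 → ℝ) : omega 0 x = 0 := by simp [omega]
theorem omega_swap (x y : Fin 2 → ℝ) : omega y x = -omega x y := by simp [omega]; ring
theorem omegaC_cvec (x y : Fin 2 → ℝ) : omegaC (cvec x) (cvec y) = omega x y := by
  simp [omega, omegaC, cvec]

theorem im_omegaC (z w : Fin 2 → ℂ) :
    (omegaC z w).im = omega (reVec z) (imVec w) + omega (imVec z) (reVec w) := by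
  simp [omegaC, omega, reVec, imVec]; ring

theorem norm_exp_I_mul_omegaC (z w : Fin 2 → ℂ) : ‖Complex.exp (Complex.I * omegaC z w)‖ =
    Real.exp (-(omega (reVec z) (imVec w) + omega (imVec z) (reVec w))) := by
  rw [Complex.norm_exp, ← im_omegaC]; simp

theorem weight_zero {α₁ α₂ : ℝ} (h₁ : 0 < α₁) (h₂ : 0 < α₂) : weight α₁ α₂ 0 = 0 := by
  simp [weight, Real.zero_rpow, h₁.ne', h₂.ne']

theorem one_sub_mem_Ioo {α : ℝ} (h : α ∈ Set.Ioo (0 : ℝ) 1) : 1 - α ∈ Set.Ioo (0 : ℝ) 1 :=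
  ⟨by linarith [h.2], by linarith [h.1]⟩

/-- The estimate defining `symmetricSpace`, in terms of the weights. -/
def IsSym (α₁ α₂ : ℝ) (φ : (Fin 2 → ℂ) → ℂ) : Prop :=
  Differentiable ℂ φ ∧ ∃ a b C : ℝ, 0 < a ∧ 0 < b ∧ 0 < C ∧ ∀ z, ‖φ z‖ ≤
    C * Real.exp (-a * weight α₁ α₂ (reVec z) + b * weight (1 - α₂) (1 - α₁) (imVec z))

variable {α₁ α₂ : ℝ}

theorem mem_symmetricSpace_iff {f : (Fin 2 → ℝ) → ℂ} :
    f ∈ symmetricSpace α₁ α₂ ↔ ∃ φ, IsSym α₁ α₂ φ ∧ ∀ x, f x = φ (cvec x) := by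
  constructor
  · rintro ⟨φ, ⟨hd, a, b, C, ha, hb, hC, h⟩, hf⟩
    refine ⟨φ, ⟨hd, min (a 0) (a 1), max (b 0) (b 1), C, lt_min (ha 0) (ha 1),
      lt_max_of_lt_left (hb 0), hC, fun z => (h z).trans ?_⟩, hf⟩
    simp only [Fin.sum_univ_two, weight, reVec, imVec, Matrix.cons_val_zero, Matrix.cons_val_one]
    have q1 : min (a 0) (a 1) * |(z 0).re| ^ (1 / α₁) ≤ a 0 * |(z 0).re| ^ (1 / α₁) := by
      gcongr; exact min_le_left _ _
    have q2 : min (a 0) (a 1) * |(z 1).re| ^ (1 / α₂) ≤ a 1 * |(z 1).re| ^ (1 / α₂) := by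
      gcongr; exact min_le_right _ _
    have q3 : b 0 * |(z 0).im| ^ (1 / (1 - α₂)) ≤ max (b 0) (b 1) * |(z 0).im| ^ (1 / (1 - α₂)) := by
      gcongr; exact le_max_left _ _
    have q4 : b 1 * |(z 1).im| ^ (1 / (1 - α₁)) ≤ max (b 0) (b 1) * |(z 1).im| ^ (1 / (1 - α₁)) := by
      gcongr; exact le_max_right _ _
    refine mul_le_mul_of_nonneg_left (Real.exp_le_exp.2 ?_) (by positivity)
    linarith
  · rintro ⟨φ, ⟨hd, a, b, C, ha, hb, hC, h⟩, hf⟩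
    refine ⟨φ, ⟨hd, fun _ => a, fun _ => b, C, fun _ => ha, fun _ => hb, hC, fun z =>
      (h z).trans_eq ?_⟩, hf⟩
    simp only [Fin.sum_univ_two, weight, reVec, imVec, Matrix.cons_val_zero, Matrix.cons_val_one]
    ring_nf

theorem span_range_cvec : Submodule.span ℂ (Set.range cvec) = ⊤ := by
  rw [eq_top_iff]
  intro z _
  have : z = z 0 • cvec ![1, 0] + z 1 • cvec ![0, 1] := by
    ext j; fin_cases j <;> simp [cvec]
  rw [this]
  exact add_mem (Submodule.smul_mem _ _ (Submodule.subset_span ⟨_, rfl⟩))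
    (Submodule.smul_mem _ _ (Submodule.subset_span ⟨_, rfl⟩))

/-- Makes a continuous bound locally uniform at the cost of `+1`; it supplies the neighbourhoods
required by `differentiableAt_integral`. -/
theorem setOf_lt_mem_nhds {X : Type*} [TopologicalSpace X] {H : X → ℝ} (hH : Continuous H) (x : X) :
    {y | H y < H x + 1} ∈ nhds x :=
  (isOpen_lt hH continuous_const).mem_nhds (by simp)

/-- The integral over `ℝ² + iy` of an entire function with decay in the real directions does not
depend on `y`. -/
theorem integral_add_I_smul_eq (h₁ : α₁ ∈ Set.Ioo (0 : ℝ) 1) (h₂ : α₂ ∈ Set.Ioo (0 : ℝ) 1)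
    {G : (Fin 2 → ℂ) → ℂ} (hG : Differentiable ℂ G) {a : ℝ} (ha : 0 < a)
    {B : (Fin 2 → ℝ) → ℝ} (hB : Continuous B)
    (hb : ∀ z, ‖G z‖ ≤ Real.exp (-a * weight α₁ α₂ (reVec z) + B (imVec z))) (y : Fin 2 → ℝ) :
    ∫ x, G (cvec x + Complex.I • cvec y) = ∫ x, G (cvec x) := by
  obtain ⟨A, hA, hAw⟩ := exists_weight_add_le h₁.1 h₂.1
  have hA0 : 0 < A := by linarith
  set J : (Fin 2 → ℂ) → ℂ := fun w => ∫ x, G (cvec x + w) with hJ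
  have hdiff : Differentiable ℂ J := by
    intro w
    have hc : Continuous fun v : Fin 2 → ℂ => a * weight α₁ α₂ (reVec v) + B (imVec v) :=
      (((continuous_weight h₁.1 h₂.1).comp continuous_reVec).const_mul a).add
        (hB.comp continuous_imVec)
    set M := a * weight α₁ α₂ (reVec w) + B (imVec w) + 1
    refine differentiableAt_integral (setOf_lt_mem_nhds hc w)
      (g := fun x => Real.exp M * Real.exp (-(a / A) * weight α₁ α₂ x)) (fun v _ => ?_)
      (fun x => ?_) ((integrable_exp_neg_weight h₁ h₂ (by positivity)).const_mul _)
      (fun v hv x => (hb _).trans ?_)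
    · exact (hG.continuous.comp (continuous_cvec.add continuous_const)).aestronglyMeasurable
    · exact (hG.comp (differentiable_id.const_add _)).differentiableOn
    · rw [← Real.exp_add]
      have e := hAw (x + reVec v) (-reVec v)
      rw [add_neg_cancel_right, weight_neg] at e
      have e2 : a / A * weight α₁ α₂ x ≤
          a * (weight α₁ α₂ (x + reVec v) + weight α₁ α₂ (reVec v)) := by
        rw [div_mul_eq_mul_div, div_le_iff₀ hA0, mul_assoc]
        gcongr
        linarith
      have hv' : a * weight α₁ α₂ (reVec v) + B (imVec v) < M := hv
      simp only [reVec_add, reVec_cvec, imVec_add, imVec_cvec, zero_add]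
      refine Real.exp_le_exp.2 ?_
      linarith
  -- Real translations leave the integral unchanged by invariance of Lebesgue measure. They span
  -- `ℂ²` over `ℂ`, so holomorphy forces the derivative to vanish, which gives the contour shift
  -- without Cauchy's theorem.
  have hconst : ∀ w, fderiv ℂ J w = 0 := fun w => by
    refine fderiv_eq_zero_of_span (hdiff w) span_range_cvec ?_
    rintro _ ⟨v, rfl⟩
    refine .of_forall fun t => ?_
    have : ∀ x, cvec x + (w + (t : ℂ) • cvec v) = cvec (x + t • v) + w := fun x => by
      ext j; simp [cvec]; ring
    simp only [hJ, this]
    exact integral_add_right_eq_self (fun x => G (cvec x + w)) (t • v)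
  have := is_const_of_fderiv_eq_zero hdiff hconst (Complex.I • cvec y) 0
  simpa [hJ] using this

/-- The entire extension of the symplectic Fourier transform. -/
def sfExt (φ : (Fin 2 → ℂ) → ℂ) (ζ : Fin 2 → ℂ) : ℂ :=
  ∫ x : Fin 2 → ℝ, Complex.exp (Complex.I * omegaC (cvec x) ζ) * φ (cvec x)

/-- Half of the decay pays for `ω(Re z, Im ζ)`. The other cross term `ω(Im z, Re ζ)` is kept exact,
because the contour shift draws the decay in `Re ζ` from it. -/
theorem IsSym.exists_norm_kernel_mul_le (h₁ : α₁ ∈ Set.Ioo (0 : ℝ) 1)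
    (h₂ : α₂ ∈ Set.Ioo (0 : ℝ) 1) {φ : (Fin 2 → ℂ) → ℂ} (hφ : IsSym α₁ α₂ φ) :
    ∃ a b K C : ℝ, 0 < a ∧ 0 < b ∧ 0 < K ∧ 0 < C ∧ ∀ z ζ,
      ‖Complex.exp (Complex.I * omegaC z ζ) * φ z‖ ≤ C * Real.exp (-a * weight α₁ α₂ (reVec z) +
        (b * weight (1 - α₂) (1 - α₁) (imVec z) + K * weight (1 - α₂) (1 - α₁) (imVec ζ)
          - omega (imVec z) (reVec ζ))) := by
  obtain ⟨-, a, b, C, ha, hb, hC, h⟩ := hφ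
  obtain ⟨K, hK, hKw⟩ := exists_abs_omega_le h₁ h₂ (half_pos ha)
  refine ⟨a / 2, b, K, C, by positivity, hb, hK, hC, fun z ζ => ?_⟩
  rw [norm_mul, norm_exp_I_mul_omegaC]
  refine (mul_le_mul_of_nonneg_left (h z) (Real.exp_pos _).le).trans ?_
  rw [mul_left_comm, ← Real.exp_add]
  have := neg_le_of_abs_le (hKw (reVec z) (imVec ζ))
  refine mul_le_mul_of_nonneg_left (Real.exp_le_exp.2 ?_) (by positivity)
  linarith

/-- Domination on the real plane gives holomorphy. For the decay, the integral is moved to `ℝ² + iy`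
with `y` depending on `Re ζ`, so that the kernel gains `exp(-a' weight(Re ζ))` after paying for the
growth in `y`. -/
theorem isSym_sfExt (h₁ : α₁ ∈ Set.Ioo (0 : ℝ) 1)
    (h₂ : α₂ ∈ Set.Ioo (0 : ℝ) 1) {φ : (Fin 2 → ℂ) → ℂ} (hφ : IsSym α₁ α₂ φ) :
    IsSym α₁ α₂ (sfExt φ) := by
  obtain ⟨a, b, K, C, ha, hb, hK, hC, h⟩ := hφ.exists_norm_kernel_mul_le h₁ h₂
  have hd := hφ.1
  have h₁' := one_sub_mem_Ioo h₁
  have h₂' := one_sub_mem_Ioo h₂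
  have hcw := continuous_weight h₂'.1 h₁'.1
  have hint := integrable_exp_neg_weight h₁ h₂ ha
  refine ⟨fun ζ => ?_, ?_⟩
  · have hc : Continuous fun ζ => K * weight (1 - α₂) (1 - α₁) (imVec ζ) :=
      (hcw.comp continuous_imVec).const_mul K
    refine differentiableAt_integral (setOf_lt_mem_nhds hc ζ)
      (g := fun x => C * Real.exp (K * weight (1 - α₂) (1 - α₁) (imVec ζ) + 1) *
        Real.exp (-a * weight α₁ α₂ x)) (fun v _ => ?_)
      (fun x => ?_) (hint.const_mul _) (fun v hv x => (h _ _).trans ?_)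
    · exact (((continuous_omegaC continuous_cvec continuous_const).const_mul _).cexp.mul
        (hd.continuous.comp continuous_cvec)).aestronglyMeasurable
    · exact (((differentiable_omegaC_right _).const_mul _).cexp.mul_const _).differentiableOn
    · have hv' : K * weight (1 - α₂) (1 - α₁) (imVec v)
        < K * weight (1 - α₂) (1 - α₁) (imVec ζ) + 1 := hv
      rw [mul_assoc, ← Real.exp_add]
      simp only [imVec_cvec, weight_zero h₂'.1 h₁'.1, reVec_cvec, omega_zero_left]
      refine mul_le_mul_of_nonneg_left (Real.exp_le_exp.2 ?_) (by positivity)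
      linarith
  · obtain ⟨a', ha', hLeg⟩ := exists_weight_add_omega_le h₁ h₂ hb
    set D := ∫ x : Fin 2 → ℝ, Real.exp (-a * weight α₁ α₂ x)
    have hD : 0 ≤ D := integral_nonneg fun _ => (Real.exp_pos _).le
    refine ⟨a', K, C * (D + 1), ha', hK, by positivity, fun ζ => ?_⟩
    obtain ⟨y, hy⟩ := hLeg (reVec ζ)
    set B : (Fin 2 → ℝ) → ℝ := fun y => Real.log C + (b * weight (1 - α₂) (1 - α₁) y +
      K * weight (1 - α₂) (1 - α₁) (imVec ζ) - omega y (reVec ζ))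
    have hB : Continuous B := continuous_const.add
      (((hcw.const_mul b).add continuous_const).sub (continuous_omega continuous_id continuous_const))
    have hbd : ∀ z, ‖Complex.exp (Complex.I * omegaC z ζ) * φ z‖ ≤
        Real.exp (-a * weight α₁ α₂ (reVec z) + B (imVec z)) := fun z => by
      refine (h z ζ).trans_eq ?_
      conv_lhs => rw [← Real.exp_log hC, ← Real.exp_add]
      simp only [B]; congr 1; ring
    have hshift := integral_add_I_smul_eq h₁ h₂
      (G := fun z => Complex.exp (Complex.I * omegaC z ζ) * φ z)
      (((differentiable_omegaC_left _).const_mul _).cexp.mul hd) ha hB hbd y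
    rw [sfExt, ← hshift]
    calc _ ≤ ∫ x, Real.exp (B y) * Real.exp (-a * weight α₁ α₂ x) := by
          refine norm_integral_le_of_norm_le (hint.const_mul _) (.of_forall fun x => ?_)
          refine (hbd _).trans_eq ?_
          rw [Real.exp_add, mul_comm]
          simp
      _ = Real.exp (B y) * D := integral_const_mul _ _
      _ ≤ Real.exp (B y) * (D + 1) := by gcongr; linarith
      _ ≤ (C * Real.exp (-a' * weight α₁ α₂ (reVec ζ) +
            K * weight (1 - α₂) (1 - α₁) (imVec ζ))) * (D + 1) := by
          gcongr
          simp only [B]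
          rw [Real.exp_add, Real.exp_log hC]
          gcongr
          rw [omega_swap]
          rw [omega_swap] at hy
          rw [omega_swap] at hy
          linarith
      _ = _ := by ring

/-- The entire extension of the twisted convolution. -/
def tcExt (q : ℝ) (φ ψ : (Fin 2 → ℂ) → ℂ) (ζ : Fin 2 → ℂ) : ℂ :=
  ∫ y : Fin 2 → ℝ, Complex.exp (Complex.I * (q * omegaC ζ (cvec y))) *
    (φ (cvec y) * ψ (ζ - cvec y))

theorem isSym_tcExt (h₁ : α₁ ∈ Set.Ioo (0 : ℝ) 1)
    (h₂ : α₂ ∈ Set.Ioo (0 : ℝ) 1) (q : ℝ) {φ ψ : (Fin 2 → ℂ) → ℂ} (hφ : IsSym α₁ α₂ φ)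
    (hψ : IsSym α₁ α₂ ψ) : IsSym α₁ α₂ (tcExt q φ ψ) := by
  obtain ⟨hdφ, a₁, b₁, C₁, ha₁, -, hC₁, hφ⟩ := hφ
  obtain ⟨hdψ, a₂, b₂, C₂, ha₂, hb₂, hC₂, hψ⟩ := hψ
  have h₁' := one_sub_mem_Ioo h₁
  have h₂' := one_sub_mem_Ioo h₂
  have hcw := continuous_weight h₂'.1 h₁'.1
  obtain ⟨A, hA, hAw⟩ := exists_weight_add_le h₁.1 h₂.1
  -- The decay `a₁` of `φ` is split: one half absorbs the twisting kernel, one quarter helps to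
  -- produce decay in `Re ζ`, and one quarter remains for integrability in `y`. Using `|q| + 1`
  -- avoids dividing by zero.
  obtain ⟨K, hK, hKw⟩ := exists_abs_omega_le h₁ h₂ (ε := a₁ / 2 / (|q| + 1)) (by positivity)
  set c := min (a₁ / 4) a₂
  have hc : 0 < c := lt_min (by positivity) ha₂
  set b := (|q| + 1) * K + b₂
  have hb : 0 < b := by positivity
  have hbound : ∀ ζ y, ‖Complex.exp (Complex.I * (q * omegaC ζ (cvec y))) *
      (φ (cvec y) * ψ (ζ - cvec y))‖ ≤ C₁ * C₂ * Real.exp (-(c / A) * weight α₁ α₂ (reVec ζ) +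
        b * weight (1 - α₂) (1 - α₁) (imVec ζ)) * Real.exp (-(a₁ / 4) * weight α₁ α₂ y) := by
    intro ζ y
    have e1 : ‖Complex.exp (Complex.I * (q * omegaC ζ (cvec y)))‖ =
        Real.exp (-(q * omega (imVec ζ) y)) := by
      rw [Complex.norm_exp]
      have := im_omegaC ζ (cvec y)
      simp only [imVec_cvec, reVec_cvec] at this
      simp [this, omega]
    have e2 : -(q * omega (imVec ζ) y) ≤ a₁ / 2 * weight α₁ α₂ y +
        (|q| + 1) * K * weight (1 - α₂) (1 - α₁) (imVec ζ) := by
      calc -(q * omega (imVec ζ) y) ≤ |q| * |omega y (imVec ζ)| := by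
            rw [omega_swap, mul_neg, neg_neg, ← abs_mul]; exact le_abs_self _
        _ ≤ (|q| + 1) * |omega y (imVec ζ)| := by gcongr; linarith
        _ ≤ (|q| + 1) * (a₁ / 2 / (|q| + 1) * weight α₁ α₂ y +
            K * weight (1 - α₂) (1 - α₁) (imVec ζ)) := by gcongr; exact hKw _ _
        _ = _ := by field_simp
    have e3 := hφ (cvec y)
    have e4 := hψ (ζ - cvec y)
    simp only [reVec_cvec, imVec_cvec, reVec_sub, imVec_sub, weight_zero h₂'.1 h₁'.1,
      sub_zero] at e3 e4
    have e5 := hAw (reVec ζ - y) y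
    rw [sub_add_cancel] at e5
    have e6 : c / A * weight α₁ α₂ (reVec ζ) ≤
        a₂ * weight α₁ α₂ (reVec ζ - y) + a₁ / 4 * weight α₁ α₂ y := by
      have hw1 := weight_nonneg (α₁ := α₁) (α₂ := α₂) (reVec ζ - y)
      have hw2 := weight_nonneg (α₁ := α₁) (α₂ := α₂) y
      calc c / A * weight α₁ α₂ (reVec ζ) ≤
          c / A * (A * (weight α₁ α₂ (reVec ζ - y) + weight α₁ α₂ y)) := by gcongr
        _ = c * weight α₁ α₂ (reVec ζ - y) + c * weight α₁ α₂ y := by field_simp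
        _ ≤ _ := by
          gcongr
          · exact min_le_right _ _
          · exact min_le_left _ _
    rw [norm_mul, norm_mul, e1]
    calc _ ≤ Real.exp (a₁ / 2 * weight α₁ α₂ y +
          (|q| + 1) * K * weight (1 - α₂) (1 - α₁) (imVec ζ)) *
          ((C₁ * Real.exp (-a₁ * weight α₁ α₂ y + b₁ * 0)) *
          (C₂ * Real.exp (-a₂ * weight α₁ α₂ (reVec ζ - y) +
            b₂ * weight (1 - α₂) (1 - α₁) (imVec ζ)))) := by gcongr
      _ = C₁ * C₂ * Real.exp (a₁ / 2 * weight α₁ α₂ y +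
          (|q| + 1) * K * weight (1 - α₂) (1 - α₁) (imVec ζ) + (-a₁ * weight α₁ α₂ y + b₁ * 0) +
          (-a₂ * weight α₁ α₂ (reVec ζ - y) + b₂ * weight (1 - α₂) (1 - α₁) (imVec ζ))) := by
        rw [Real.exp_add (_ + _ + _), Real.exp_add (_ + _)]; ring
      _ ≤ _ := by
        rw [mul_assoc (C₁ * C₂), ← Real.exp_add]
        simp only [b]
        refine mul_le_mul_of_nonneg_left (Real.exp_le_exp.2 ?_) (by positivity)
        linarith
  have hint := integrable_exp_neg_weight h₁ h₂ (a := a₁ / 4) (by positivity)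
  refine ⟨fun ζ => ?_, ?_⟩
  · have hc : Continuous fun ζ => -(c / A) * weight α₁ α₂ (reVec ζ) +
        b * weight (1 - α₂) (1 - α₁) (imVec ζ) :=
      (((continuous_weight h₁.1 h₂.1).comp continuous_reVec).const_mul _).add
        ((hcw.comp continuous_imVec).const_mul b)
    refine differentiableAt_integral (setOf_lt_mem_nhds hc ζ) (fun v _ => ?_)
      (fun x => ?_) (hint.const_mul (C₁ * C₂ * Real.exp (-(c / A) * weight α₁ α₂ (reVec ζ) +
        b * weight (1 - α₂) (1 - α₁) (imVec ζ) + 1))) (fun v hv x => (hbound _ _).trans ?_)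
    · exact ((((continuous_omegaC continuous_const continuous_cvec).const_mul _).const_mul _).cexp.mul
        ((hdφ.continuous.comp continuous_cvec).mul
          (hdψ.continuous.comp (continuous_const.sub continuous_cvec)))).aestronglyMeasurable
    · exact ((((differentiable_omegaC_left _).const_mul _).const_mul _).cexp.mul
        ((hdψ.comp (differentiable_id.sub_const _)).const_mul _)).differentiableOn
    · refine mul_le_mul_of_nonneg_right (mul_le_mul_of_nonneg_left (Real.exp_le_exp.2 ?_)
        (by positivity)) (Real.exp_pos _).le
      exact le_of_lt hv
  · set D := ∫ x : Fin 2 → ℝ, Real.exp (-(a₁ / 4) * weight α₁ α₂ x)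
    have hD : 0 ≤ D := integral_nonneg fun _ => (Real.exp_pos _).le
    refine ⟨c / A, b, C₁ * C₂ * (D + 1), by positivity, hb, by positivity, fun ζ => ?_⟩
    refine (norm_integral_le_of_norm_le (hint.const_mul _)
      (.of_forall fun x => hbound ζ x)).trans ?_
    rw [integral_const_mul, mul_right_comm]
    gcongr
    linarith

end TwistedWeyl

namespace TwistedWeyl

/-! ### Fourier inversion and partial Laplace transforms -/

open FourierTransform in
-- Fourier inversion in the normalisation without `2π` in the exponent, obtained by the substitution
-- `y = -2πw`.
theorem integral_exp_neg_mul_integral_exp_mul {g : ℝ → ℂ} (hc : Continuous g) (hi : Integrable g)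
    (hh : Integrable fun y : ℝ => ∫ t : ℝ, Complex.exp (Complex.I * y * t) * g t) (x : ℝ) :
    ∫ y : ℝ, Complex.exp (-(Complex.I * y * x)) *
      (∫ t : ℝ, Complex.exp (Complex.I * y * t) * g t) = 2 * Real.pi * g x := by
  set h : ℝ → ℂ := fun y => ∫ t : ℝ, Complex.exp (Complex.I * y * t) * g t
  have hpi := Real.pi_pos
  have hF : 𝓕 g = fun w => h (-(2 * Real.pi) * w) := by
    funext w
    rw [Real.fourier_real_eq_integral_exp_smul]
    refine integral_congr_ae (.of_forall fun t => ?_)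
    simp only [smul_eq_mul]
    congr 2
    push_cast
    ring
  have hFi : Integrable (𝓕 g) := by
    rw [hF]
    exact hh.comp_mul_left' (by simp [hpi.ne'])
  have key := congrFun (hc.fourierInv_fourier_eq hi hFi) x
  rw [Real.fourierInv_eq', hF] at key
  have e : ∀ w : ℝ, Complex.exp (↑(2 * Real.pi * inner ℝ w x) * Complex.I) •
      h (-(2 * Real.pi) * w) = (fun y : ℝ => Complex.exp (-(Complex.I * y * x)) * h y)
        (-(2 * Real.pi) * w) := fun w => by
    simp only [smul_eq_mul]
    congr 2
    simp
    ring
  simp_rw [e] at key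
  rw [Measure.integral_comp_mul_left (fun y : ℝ => Complex.exp (-(Complex.I * y * x)) * h y)] at key
  rw [← key, inv_neg, abs_neg, abs_of_pos (by positivity), Complex.real_smul]
  push_cast
  rw [mul_inv_cancel_left₀ (by simp [hpi.ne'])]

theorem integrable_comp_vec_two {f : (Fin 2 → ℝ) → ℂ} (hf : Integrable f) :
    Integrable fun p : ℝ × ℝ => f ![p.1, p.2] := by
  have h := (volume_preserving_finTwoArrow ℝ).symm
  have := (h.integrable_comp_emb (MeasurableEquiv.measurableEmbedding _) (g := f)).2 hf
  refine this.congr (.of_forall fun p => ?_)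
  simp only [Function.comp]
  congr 1

theorem integral_fin_two {f : (Fin 2 → ℝ) → ℂ} (hf : Integrable f) :
    ∫ x, f x = ∫ x : ℝ, ∫ s : ℝ, f ![x, s] := by
  have h := (volume_preserving_finTwoArrow ℝ).symm
  rw [← h.integral_comp (MeasurableEquiv.measurableEmbedding _),
    ← integral_prod (fun p : ℝ × ℝ => f ![p.1, p.2]) (integrable_comp_vec_two hf)]
  refine integral_congr_ae (.of_forall fun p => ?_)
  congr 1

variable {α₁ α₂ : ℝ}

theorem IsSym.continuous {φ : (Fin 2 → ℂ) → ℂ} (hφ : IsSym α₁ α₂ φ) :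
    Continuous fun x => φ (cvec x) :=
  hφ.1.continuous.comp continuous_cvec

theorem IsSym.integrable_kernel_mul (h₁ : α₁ ∈ Set.Ioo (0 : ℝ) 1)
    (h₂ : α₂ ∈ Set.Ioo (0 : ℝ) 1) {φ : (Fin 2 → ℂ) → ℂ} (hφ : IsSym α₁ α₂ φ) (ζ : Fin 2 → ℂ) :
    Integrable fun x => Complex.exp (Complex.I * omegaC (cvec x) ζ) * φ (cvec x) := by
  obtain ⟨a, b, K, C, ha, hb, hK, hC, h⟩ := hφ.exists_norm_kernel_mul_le h₁ h₂
  refine ((integrable_exp_neg_weight h₁ h₂ ha).const_mul (C * Real.exp (b * weight (1 - α₂) (1 - α₁) 0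
    + K * weight (1 - α₂) (1 - α₁) (imVec ζ) - omega 0 (reVec ζ)))).mono' ?_
      (.of_forall fun x => (h _ _).trans_eq ?_)
  · exact (((continuous_omegaC continuous_cvec continuous_const).const_mul _).cexp.mul
      hφ.continuous).aestronglyMeasurable
  · rw [Real.exp_add, reVec_cvec, imVec_cvec]; ring

theorem IsSym.integrable (h₁ : α₁ ∈ Set.Ioo (0 : ℝ) 1)
    (h₂ : α₂ ∈ Set.Ioo (0 : ℝ) 1) {φ : (Fin 2 → ℂ) → ℂ} (hφ : IsSym α₁ α₂ φ) :
    Integrable fun x => φ (cvec x) := by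
  simpa [omegaC] using hφ.integrable_kernel_mul h₁ h₂ 0

/-- The Laplace kernel `exp(-ws)` is the symplectic kernel at `ζ = (-iw, 0)`, whose imaginary part
involves only `Re w`; the kernel bound therefore holds uniformly on vertical strips. -/
theorem IsSym.exists_norm_exp_mul_slice_le (h₁ : α₁ ∈ Set.Ioo (0 : ℝ) 1)
    (h₂ : α₂ ∈ Set.Ioo (0 : ℝ) 1) {φ : (Fin 2 → ℂ) → ℂ} (hφ : IsSym α₁ α₂ φ) (R : ℝ) :
    ∃ a C : ℝ, 0 < a ∧ 0 < C ∧ ∀ w : ℂ, |w.re| ≤ R → ∀ x s : ℝ,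
      ‖Complex.exp (-w * s) * φ (cvec ![x, s])‖ ≤ C * Real.exp (-a * |s| ^ (1 / α₂)) := by
  obtain ⟨a, b, K, C, ha, hb, hK, hC, h⟩ := hφ.exists_norm_kernel_mul_le h₁ h₂
  have h₁' := one_sub_mem_Ioo h₁
  have h₂' := one_sub_mem_Ioo h₂
  refine ⟨a, C * Real.exp (K * R ^ (1 / (1 - α₂))), ha, by positivity, fun w hw x s => ?_⟩
  have e := h (cvec ![x, s]) ![-Complex.I * w, 0]
  have e1 : Complex.I * omegaC (cvec ![x, s]) ![-Complex.I * w, 0] = -w * s := by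
    simp only [omegaC, cvec, Matrix.cons_val_zero, Matrix.cons_val_one]
    linear_combination (w * s) * Complex.I_mul_I
  rw [e1] at e
  refine e.trans ?_
  simp only [reVec_cvec, imVec_cvec, weight_zero h₂'.1 h₁'.1, omega_zero_left]
  rw [mul_assoc, ← Real.exp_add]
  refine mul_le_mul_of_nonneg_left (Real.exp_le_exp.2 ?_) hC.le
  have h1 : (0 : ℝ) ≤ |x| ^ (1 / α₁) := by positivity
  have h2 : weight (1 - α₂) (1 - α₁) (imVec ![-Complex.I * w, 0]) ≤ R ^ (1 / (1 - α₂)) := by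
    have := h₁'.1
    have := h₂'.1
    simp only [weight, imVec, Matrix.cons_val_zero, Matrix.cons_val_one]
    rw [Complex.zero_im, abs_zero, Real.zero_rpow (by positivity)]
    simp only [Complex.mul_im, Complex.neg_re, Complex.I_re, Complex.neg_im, Complex.I_im]
    simp only [neg_zero, zero_mul, neg_mul, one_mul, zero_add, abs_neg, add_zero]
    gcongr
  have h3 : K * weight (1 - α₂) (1 - α₁) (imVec ![-Complex.I * w, 0]) ≤
    K * R ^ (1 / (1 - α₂)) := by gcongr
  simp only [weight, Matrix.cons_val_zero, Matrix.cons_val_one] at h3 ⊢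
  have h4 : 0 ≤ a * |x| ^ (1 / α₁) := by positivity
  linarith

theorem continuous_vec_two {X : Type*} [TopologicalSpace X] {f g : X → ℝ} (hf : Continuous f)
    (hg : Continuous g) : Continuous fun x => ![f x, g x] :=
  continuous_pi fun j => by fin_cases j <;> simpa

theorem IsSym.integrable_exp_mul_slice (h₁ : α₁ ∈ Set.Ioo (0 : ℝ) 1)
    (h₂ : α₂ ∈ Set.Ioo (0 : ℝ) 1) {φ : (Fin 2 → ℂ) → ℂ} (hφ : IsSym α₁ α₂ φ) (w : ℂ) (x : ℝ) :
    Integrable fun s : ℝ => Complex.exp (-w * s) * φ (cvec ![x, s]) := by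
  obtain ⟨a, C, ha, hC, h⟩ := hφ.exists_norm_exp_mul_slice_le h₁ h₂ |w.re|
  refine ((integrable_exp_neg_rpow (holderConjugate_one_div h₂).lt.le ha).const_mul C).mono' ?_
    (.of_forall fun s => h w le_rfl x s)
  have := hφ.continuous.comp (continuous_vec_two (continuous_const (y := x)) continuous_id)
  exact ((by fun_prop : Continuous fun s : ℝ => Complex.exp (-w * s)).mul this).aestronglyMeasurable

theorem IsSym.integrable_slice (h₁ : α₁ ∈ Set.Ioo (0 : ℝ) 1)
    (h₂ : α₂ ∈ Set.Ioo (0 : ℝ) 1) {φ : (Fin 2 → ℂ) → ℂ} (hφ : IsSym α₁ α₂ φ) (x : ℝ) :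
    Integrable fun s : ℝ => φ (cvec ![x, s]) := by
  simpa using hφ.integrable_exp_mul_slice h₁ h₂ 0 x

/-- The partial Laplace transform of a function in the symmetric space is entire. -/
theorem IsSym.differentiable_laplace (h₁ : α₁ ∈ Set.Ioo (0 : ℝ) 1)
    (h₂ : α₂ ∈ Set.Ioo (0 : ℝ) 1) {φ : (Fin 2 → ℂ) → ℂ} (hφ : IsSym α₁ α₂ φ) (x : ℝ) :
    Differentiable ℂ fun w => laplace (fun s => φ (cvec ![x, s])) w := by
  intro w
  obtain ⟨a, C, ha, hC, h⟩ := hφ.exists_norm_exp_mul_slice_le h₁ h₂ (|w.re| + 1)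
  refine differentiableAt_integral (setOf_lt_mem_nhds
    (by fun_prop : Continuous fun v : ℂ => |v.re|) w)
    (fun v _ => (hφ.integrable_exp_mul_slice h₁ h₂ v x).1) (fun s => ?_)
    ((integrable_exp_neg_rpow (holderConjugate_one_div h₂).lt.le ha).const_mul C)
    (fun v hv s => h v (le_of_lt hv) x s)
  fun_prop

theorem IsSym.continuous_laplace (h₁ : α₁ ∈ Set.Ioo (0 : ℝ) 1)
    (h₂ : α₂ ∈ Set.Ioo (0 : ℝ) 1) {φ : (Fin 2 → ℂ) → ℂ} (hφ : IsSym α₁ α₂ φ) (w : ℂ) :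
    Continuous fun x : ℝ => laplace (fun s => φ (cvec ![x, s])) w := by
  obtain ⟨a, C, ha, hC, h⟩ := hφ.exists_norm_exp_mul_slice_le h₁ h₂ |w.re|
  refine continuous_of_dominated (fun x => (hφ.integrable_exp_mul_slice h₁ h₂ w x).1)
    (fun x => .of_forall fun s => h w le_rfl x s)
    ((integrable_exp_neg_rpow (holderConjugate_one_div h₂).lt.le ha).const_mul C)
    (.of_forall fun s => ?_)
  exact (hφ.continuous.comp (continuous_vec_two continuous_id continuous_const)).const_mul _

/-- Since `-iw` has real part `Im w` and imaginary part `-Re w`, decay along the real plane becomes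
decay along vertical strips in `w`. -/
theorem IsSym.exists_norm_slice_le (h₂ : α₂ ∈ Set.Ioo (0 : ℝ) 1)
    {ψ : (Fin 2 → ℂ) → ℂ} (hψ : IsSym α₁ α₂ ψ) (R : ℝ) :
    ∃ a C : ℝ, 0 < a ∧ 0 < C ∧ ∀ w : ℂ, |w.re| ≤ R → ∀ y : ℝ,
      ‖ψ ![-Complex.I * w, y]‖ ≤
        C * (Real.exp (-a * |w.im| ^ (1 / α₁)) * Real.exp (-a * |y| ^ (1 / α₂))) := by
  obtain ⟨-, a, b, C, ha, hb, hC, h⟩ := hψ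
  refine ⟨a, C * Real.exp (b * (R ^ (1 / (1 - α₂)) + |0| ^ (1 / (1 - α₁)))), ha, by positivity,
    fun w hw y => (h _).trans ?_⟩
  rw [mul_assoc, ← Real.exp_add, ← Real.exp_add]
  refine mul_le_mul_of_nonneg_left (Real.exp_le_exp.2 ?_) hC.le
  simp only [weight, reVec, imVec, Matrix.cons_val_zero, Matrix.cons_val_one]
  simp only [Complex.mul_im, Complex.mul_re, Complex.neg_re, Complex.I_re, Complex.neg_im,
    Complex.I_im, Complex.ofReal_re, Complex.ofReal_im]
  simp only [neg_zero, zero_mul, neg_mul, one_mul, zero_add, zero_sub, neg_neg, abs_neg]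
  have h2 : b * |w.re| ^ (1 / (1 - α₂)) ≤ b * R ^ (1 / (1 - α₂)) := by
    have := (one_sub_mem_Ioo h₂).1
    gcongr
  linarith

/-- The partial Laplace transform in terms of the symplectic Fourier transform. -/
theorem IsSym.laplace_slice_eq (h₁ : α₁ ∈ Set.Ioo (0 : ℝ) 1)
    (h₂ : α₂ ∈ Set.Ioo (0 : ℝ) 1) {φ : (Fin 2 → ℂ) → ℂ} (hφ : IsSym α₁ α₂ φ) (w : ℂ) (x : ℝ) :
    2 * Real.pi * laplace (fun s => φ (cvec ![x, s])) w =
      ∫ y : ℝ, Complex.exp (-(Complex.I * y * x)) * sfExt φ ![-Complex.I * w, y] := by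
  have hexp : ∀ y x s : ℝ, Complex.I * omegaC (cvec ![x, s]) ![-Complex.I * w, y] =
      Complex.I * y * x + -w * s := fun y x s => by
    simp only [omegaC, cvec, Matrix.cons_val_zero, Matrix.cons_val_one]
    linear_combination (w * s) * Complex.I_mul_I
  -- By Fubini, the Fourier transform in the free variable of the partial Laplace transform is a
  -- slice of the symplectic Fourier transform; one-dimensional inversion then yields the formula.
  have hint : ∀ y : ℝ, ∫ t : ℝ, Complex.exp (Complex.I * y * t) *
      laplace (fun s => φ (cvec ![t, s])) w = sfExt φ ![-Complex.I * w, y] := fun y => by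
    rw [sfExt, integral_fin_two (hφ.integrable_kernel_mul h₁ h₂ _)]
    refine integral_congr_ae (.of_forall fun t => ?_)
    simp only [hexp, Complex.exp_add, mul_assoc, laplace]
    rw [integral_const_mul]
  have hi : Integrable fun t : ℝ => laplace (fun s => φ (cvec ![t, s])) w := by
    have := (integrable_comp_vec_two
      (hφ.integrable_kernel_mul h₁ h₂ ![-Complex.I * w, (0 : ℝ)])).integral_prod_left
    simp only [hexp] at this
    simpa only [Complex.ofReal_zero, mul_zero, zero_mul, zero_add] using! this
  have hsf := isSym_sfExt h₁ h₂ hφ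
  obtain ⟨a, C, ha, hC, h⟩ := hsf.exists_norm_slice_le h₂ |w.re|
  have hh : Integrable fun y : ℝ => sfExt φ ![-Complex.I * w, y] := by
    refine (((integrable_exp_neg_rpow (holderConjugate_one_div h₂).lt.le ha).const_mul _).const_mul
      C).mono' ?_ (.of_forall fun y => h w le_rfl y)
    refine (hsf.1.continuous.comp (continuous_pi fun j => ?_)).aestronglyMeasurable
    fin_cases j
    · exact continuous_const
    · exact Complex.continuous_ofReal
  have := integral_exp_neg_mul_integral_exp_mul (hφ.continuous_laplace h₁ h₂ w) hi
    (by simpa only [hint] using hh) x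
  rw [← this]
  simp only [hint]

/-- The partial Laplace transform decays along vertical strips, uniformly in the parameter. -/
theorem IsSym.exists_norm_laplace_le (h₁ : α₁ ∈ Set.Ioo (0 : ℝ) 1)
    (h₂ : α₂ ∈ Set.Ioo (0 : ℝ) 1) {φ : (Fin 2 → ℂ) → ℂ} (hφ : IsSym α₁ α₂ φ) (R : ℝ) :
    ∃ a C : ℝ, 0 < a ∧ 0 < C ∧ ∀ w : ℂ, |w.re| ≤ R → ∀ x : ℝ,
      ‖laplace (fun s => φ (cvec ![x, s])) w‖ ≤ C * Real.exp (-a * |w.im| ^ (1 / α₁)) := by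
  obtain ⟨a, C, ha, hC, h⟩ := (isSym_sfExt h₁ h₂ hφ).exists_norm_slice_le h₂ R
  set D := ∫ y : ℝ, Real.exp (-a * |y| ^ (1 / α₂))
  have hD : 0 ≤ D := integral_nonneg fun _ => (Real.exp_pos _).le
  refine ⟨a, C * (D + 1), ha, by positivity, fun w hw x => ?_⟩
  have e := hφ.laplace_slice_eq h₁ h₂ w x
  have e1 : ‖2 * (Real.pi : ℂ) * laplace (fun s => φ (cvec ![x, s])) w‖ ≤
      C * Real.exp (-a * |w.im| ^ (1 / α₁)) * D := by
    rw [e, ← integral_const_mul]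
    refine norm_integral_le_of_norm_le
      ((integrable_exp_neg_rpow (holderConjugate_one_div h₂).lt.le ha).const_mul _)
      (.of_forall fun y => ?_)
    have e3 := h w hw y
    rw [← mul_assoc] at e3
    rw [norm_mul, Complex.norm_exp]
    simpa using e3
  rw [norm_mul] at e1
  have e2 : (1 : ℝ) ≤ ‖2 * (Real.pi : ℂ)‖ := by
    simp only [norm_mul, Complex.norm_ofNat, Complex.norm_real, Real.norm_eq_abs]
    rw [abs_of_pos Real.pi_pos]
    linarith [Real.pi_gt_three]
  calc _ ≤ _ := le_mul_of_one_le_left (norm_nonneg _) e2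
    _ ≤ _ := e1
    _ ≤ C * Real.exp (-a * |w.im| ^ (1 / α₁)) * (D + 1) := by gcongr; linarith
    _ = _ := by ring

theorem IsSym.integrable_laplace (h₁ : α₁ ∈ Set.Ioo (0 : ℝ) 1)
    (h₂ : α₂ ∈ Set.Ioo (0 : ℝ) 1) {φ : (Fin 2 → ℂ) → ℂ} (hφ : IsSym α₁ α₂ φ) (x : ℝ) :
    Integrable fun y : ℝ => laplace (fun s => φ (cvec ![x, s])) (-Complex.I * y) := by
  obtain ⟨a, C, ha, hC, h⟩ := hφ.exists_norm_laplace_le h₁ h₂ 0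
  refine ((integrable_exp_neg_rpow (holderConjugate_one_div h₁).lt.le ha).const_mul C).mono' ?_
    (.of_forall fun y => ?_)
  · exact ((hφ.differentiable_laplace h₁ h₂ x).continuous.comp
      (by fun_prop : Continuous fun y : ℝ => -Complex.I * (y : ℂ))).aestronglyMeasurable
  · simpa using h (-Complex.I * y) (by simp) x

/-- On the imaginary axis the Laplace transform is a Fourier transform, so this is Fourier inversion
in the second variable. -/
theorem IsSym.integral_laplace_eq (h₁ : α₁ ∈ Set.Ioo (0 : ℝ) 1)
    (h₂ : α₂ ∈ Set.Ioo (0 : ℝ) 1) {φ : (Fin 2 → ℂ) → ℂ} (hφ : IsSym α₁ α₂ φ) (x s : ℝ) :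
    ∫ y : ℝ, Complex.exp (-(Complex.I * y * s)) *
      laplace (fun s => φ (cvec ![x, s])) (-Complex.I * y) = 2 * Real.pi * φ (cvec ![x, s]) := by
  have e : ∀ y : ℝ, laplace (fun s => φ (cvec ![x, s])) (-Complex.I * y) =
      ∫ t : ℝ, Complex.exp (Complex.I * y * t) * φ (cvec ![x, t]) := fun y => by
    rw [laplace]; simp only [neg_mul, neg_neg]
  have h := hφ.integrable_laplace h₁ h₂ x
  simp only [e] at h ⊢
  exact integral_exp_neg_mul_integral_exp_mul
    (hφ.continuous.comp (continuous_vec_two continuous_const continuous_id))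
    (hφ.integrable_slice h₁ h₂ x) h s

/-- Two one-dimensional inversions in succession, each contributing `2π`. Antisymmetry of the form
is why no reflection appears; the substitution `y ↦ -y` matches the sign conventions. -/
theorem IsSym.sfExt_sfExt (h₁ : α₁ ∈ Set.Ioo (0 : ℝ) 1)
    (h₂ : α₂ ∈ Set.Ioo (0 : ℝ) 1) {φ : (Fin 2 → ℂ) → ℂ} (hφ : IsSym α₁ α₂ φ) (x : Fin 2 → ℝ) :
    sfExt (sfExt φ) (cvec x) = (2 * Real.pi) ^ 2 * φ (cvec x) := by
  have hx : x = ![x 0, x 1] := by ext j; fin_cases j <;> rfl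
  rw [sfExt, integral_fin_two ((isSym_sfExt h₁ h₂ hφ).integrable_kernel_mul h₁ h₂ _), sq, mul_assoc]
  conv_rhs => rw [hx, ← hφ.integral_laplace_eq h₁ h₂ (x 0) (x 1), ← integral_const_mul,
    ← integral_neg_eq_self]
  refine integral_congr_ae (.of_forall fun y => ?_)
  simp only
  rw [mul_left_comm, hφ.laplace_slice_eq h₁ h₂, ← integral_const_mul]
  refine integral_congr_ae (.of_forall fun t => ?_)
  simp only
  rw [← mul_assoc, ← Complex.exp_add]
  congr 2
  · simp [omegaC, cvec]; ring
  · ext j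
    fin_cases j
    · simp only [cvec, Matrix.cons_val_zero, Fin.zero_eta]
      push_cast
      linear_combination (y : ℂ) * Complex.I_mul_I
    · simp [cvec]

end TwistedWeyl

namespace TwistedWeyl

/-! ### The Weyl product on the symmetric space -/

section algebra

variable {u v w : (Fin 2 → ℝ) → ℂ} (q : ℝ)

theorem norm_exp_I_mul_mul (x y : ℝ) : ‖Complex.exp (Complex.I * (x : ℂ) * (y : ℂ))‖ = 1 := by
  rw [Complex.norm_exp]; simp

theorem continuous_exp_omega {X : Type*} [TopologicalSpace X] {f g : X → Fin 2 → ℝ}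
    (hf : Continuous f) (hg : Continuous g) :
    Continuous fun x => Complex.exp (Complex.I * (q : ℂ) * (omega (f x) (g x) : ℂ)) :=
  ((Complex.continuous_ofReal.comp (continuous_omega hf hg)).const_mul _).cexp

theorem symplecticFourier_add (hu : Integrable u) (hv : Integrable v) :
    symplecticFourier (u + v) = symplecticFourier u + symplecticFourier v := by
  funext y
  have key : ∀ {f : (Fin 2 → ℝ) → ℂ}, Integrable f → Integrable fun x : Fin 2 → ℝ =>
      Complex.exp (Complex.I * (omega x y : ℂ)) * f x := fun hf => by
    refine hf.bdd_mul (c := 1) ?_ (.of_forall fun x => ?_)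
    · simpa using (continuous_exp_omega 1 continuous_id (continuous_const (y := y))).aestronglyMeasurable
    · exact (by simp [Complex.norm_exp] : ‖_‖ = (1 : ℝ)).le
  simp only [symplecticFourier, Pi.add_apply, mul_add]
  exact integral_add (key hu) (key hv)

theorem symplecticFourier_smul (c : ℂ) (u : (Fin 2 → ℝ) → ℂ) :
    symplecticFourier (c • u) = c • symplecticFourier u := by
  funext y
  simp only [symplecticFourier, Pi.smul_apply, smul_eq_mul]
  rw [← integral_const_mul]
  simp only [mul_left_comm]

theorem integrable_twistedConv_integrand (hu : Integrable u) (hv : Continuous v) {M : ℝ}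
    (hM : ∀ x, ‖v x‖ ≤ M) (x : Fin 2 → ℝ) : Integrable fun y : Fin 2 → ℝ =>
      Complex.exp (Complex.I * (q : ℂ) * (omega x y : ℂ)) * (u y * v (x - y)) := by
  refine Integrable.bdd_mul (c := 1) (hu.mul_bdd (c := M) ?_ (.of_forall fun y => hM _)) ?_
    (.of_forall fun y => (norm_exp_I_mul_mul _ _).le)
  · exact (hv.comp (continuous_const.sub continuous_id)).aestronglyMeasurable
  · exact (continuous_exp_omega q continuous_const continuous_id).aestronglyMeasurable

theorem twistedConv_smul_left (c : ℂ) (u v : (Fin 2 → ℝ) → ℂ) :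
    twistedConv q (c • u) v = c • twistedConv q u v := by
  funext x
  simp only [twistedConv, Pi.smul_apply, smul_eq_mul]
  rw [← integral_const_mul]
  simp only [mul_left_comm, mul_assoc]

theorem twistedConv_smul_right (c : ℂ) (u v : (Fin 2 → ℝ) → ℂ) :
    twistedConv q u (c • v) = c • twistedConv q u v := by
  funext x
  simp only [twistedConv, Pi.smul_apply, smul_eq_mul]
  rw [← integral_const_mul]
  simp only [mul_left_comm]

/-- Fubini and a translation reduce the claim to `ω(x,y) + ω(y,z) = ω(x,z) + ω(x-z,y-z)`. The phases
have modulus one, so integrability is that of the ordinary convolution integrand times a bounded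
function. -/
theorem twistedConv_assoc (hu : Integrable u) (hv : Integrable v) (hw : Continuous w) {M : ℝ}
    (hM : ∀ x, ‖w x‖ ≤ M) :
    twistedConv q (twistedConv q u v) w = twistedConv q u (twistedConv q v w) := by
  funext x
  set G : (Fin 2 → ℝ) → (Fin 2 → ℝ) → ℂ := fun y z =>
    Complex.exp (Complex.I * (q : ℂ) * (omega x y : ℂ)) *
      (Complex.exp (Complex.I * (q : ℂ) * (omega y z : ℂ)) * (u z * v (y - z)) * w (x - y))
  have hG : Integrable (Function.uncurry G) (volume.prod volume) := by
    have h := hu.convolution_integrand (ContinuousLinearMap.mul ℝ ℂ) hv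
    refine Integrable.bdd_mul (c := 1) (Integrable.mul_bdd (c := M)
      (Integrable.bdd_mul (c := 1) h ?_ (.of_forall fun p => (norm_exp_I_mul_mul _ _).le)) ?_
      (.of_forall fun p => hM _)) ?_ (.of_forall fun p => (norm_exp_I_mul_mul _ _).le)
    · exact (continuous_exp_omega q continuous_fst continuous_snd).aestronglyMeasurable
    · exact (hw.comp (continuous_const.sub continuous_fst)).aestronglyMeasurable
    · exact (continuous_exp_omega q continuous_const continuous_fst).aestronglyMeasurable
  have hL : twistedConv q (twistedConv q u v) w x = ∫ y, ∫ z, G y z := by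
    refine integral_congr_ae (.of_forall fun y => ?_)
    simp only [G, twistedConv]
    rw [integral_const_mul, integral_mul_const]
  rw [hL, integral_integral_swap hG]
  refine integral_congr_ae (.of_forall fun z => ?_)
  simp only [twistedConv]
  rw [← integral_const_mul, ← integral_const_mul]
  rw [eq_comm, ← integral_sub_right_eq_self _ z, eq_comm]
  refine integral_congr_ae (.of_forall fun y => ?_)
  simp only [G]
  have e : omega x y + omega y z = omega x z + omega (x - z) (y - z) := by
    simp [omega]; ring
  have e2 : x - z - (y - z) = x - y := by abel
  rw [e2]
  have e3 : Complex.exp (Complex.I * (q : ℂ) * (omega x y : ℂ)) *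
      Complex.exp (Complex.I * (q : ℂ) * (omega y z : ℂ)) =
      Complex.exp (Complex.I * (q : ℂ) * (omega x z : ℂ)) *
      Complex.exp (Complex.I * (q : ℂ) * (omega (x - z) (y - z) : ℂ)) := by
    rw [← Complex.exp_add, ← Complex.exp_add, ← mul_add, ← mul_add]
    congr 2
    exact_mod_cast e
  linear_combination (u z * v (y - z) * w (x - y)) * e3

end algebra

variable {α₁ α₂ : ℝ} {f g h : (Fin 2 → ℝ) → ℂ}

section symmetricSpace

variable (h₁ : α₁ ∈ Set.Ioo (0 : ℝ) 1) (h₂ : α₂ ∈ Set.Ioo (0 : ℝ) 1)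
include h₁ h₂

theorem integrable_of_mem (hf : f ∈ symmetricSpace α₁ α₂) : Integrable f := by
  obtain ⟨φ, hφ, h⟩ := mem_symmetricSpace_iff.1 hf
  rw [funext h]
  exact hφ.integrable h₁ h₂

theorem exists_norm_le_of_mem (hf : f ∈ symmetricSpace α₁ α₂) : ∃ M, ∀ x, ‖f x‖ ≤ M := by
  obtain ⟨φ, ⟨-, a, b, C, ha, hb, hC, hφ⟩, h⟩ := mem_symmetricSpace_iff.1 hf
  refine ⟨C, fun x => ?_⟩
  rw [h]
  refine (hφ _).trans (mul_le_of_le_one_right hC.le (Real.exp_le_one_iff.2 ?_))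
  rw [imVec_cvec, weight_zero (one_sub_mem_Ioo h₂).1 (one_sub_mem_Ioo h₁).1]
  have := mul_nonneg ha.le (weight_nonneg (α₁ := α₁) (α₂ := α₂) (reVec (cvec x)))
  linarith

theorem symplecticFourier_mem (hf : f ∈ symmetricSpace α₁ α₂) :
    symplecticFourier f ∈ symmetricSpace α₁ α₂ := by
  obtain ⟨φ, hφ, h⟩ := mem_symmetricSpace_iff.1 hf
  refine mem_symmetricSpace_iff.2 ⟨_, isSym_sfExt h₁ h₂ hφ, fun y => ?_⟩
  simp only [symplecticFourier, sfExt, omegaC_cvec, h]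

theorem symplecticFourier_symplecticFourier (hf : f ∈ symmetricSpace α₁ α₂) :
    symplecticFourier (symplecticFourier f) = ((2 * Real.pi) ^ 2 : ℂ) • f := by
  obtain ⟨φ, hφ, h⟩ := mem_symmetricSpace_iff.1 hf
  funext y
  have := hφ.sfExt_sfExt h₁ h₂ y
  simp only [sfExt, omegaC_cvec] at this
  simpa only [symplecticFourier, h, Pi.smul_apply, smul_eq_mul] using this

theorem twistedConv_mem (q : ℝ) (hf : f ∈ symmetricSpace α₁ α₂) (hg : g ∈ symmetricSpace α₁ α₂) :
    twistedConv q f g ∈ symmetricSpace α₁ α₂ := by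
  obtain ⟨φ, hφ, h⟩ := mem_symmetricSpace_iff.1 hf
  obtain ⟨ψ, hψ, h'⟩ := mem_symmetricSpace_iff.1 hg
  refine mem_symmetricSpace_iff.2 ⟨_, isSym_tcExt h₁ h₂ q hφ hψ, fun x => ?_⟩
  have e : ∀ y, cvec (x - y) = cvec x - cvec y := fun y => by ext j; simp [cvec]
  simp only [twistedConv, tcExt, omegaC_cvec, h, h', e, mul_assoc]

theorem weyl_mem (q : ℝ) (hf : f ∈ symmetricSpace α₁ α₂) (hg : g ∈ symmetricSpace α₁ α₂) :
    weyl q f g ∈ symmetricSpace α₁ α₂ :=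
  symplecticFourier_mem h₁ h₂ (twistedConv_mem h₁ h₂ q (symplecticFourier_mem h₁ h₂ hf)
    (symplecticFourier_mem h₁ h₂ hg))

omit h₁ h₂ in
theorem continuous_of_mem (hf : f ∈ symmetricSpace α₁ α₂) : Continuous f := by
  obtain ⟨φ, hφ, h⟩ := mem_symmetricSpace_iff.1 hf
  rw [funext h]
  exact hφ.continuous

theorem twistedConv_add_left (q : ℝ) (hf : f ∈ symmetricSpace α₁ α₂)
    (hg : g ∈ symmetricSpace α₁ α₂) (hh : h ∈ symmetricSpace α₁ α₂) :
    twistedConv q (f + g) h = twistedConv q f h + twistedConv q g h := by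
  obtain ⟨M, hM⟩ := exists_norm_le_of_mem h₁ h₂ hh
  funext x
  simp only [twistedConv, Pi.add_apply, add_mul, mul_add]
  exact integral_add
    (integrable_twistedConv_integrand q (integrable_of_mem h₁ h₂ hf) (continuous_of_mem hh) hM x)
    (integrable_twistedConv_integrand q (integrable_of_mem h₁ h₂ hg) (continuous_of_mem hh) hM x)

theorem twistedConv_add_right (q : ℝ) (hf : f ∈ symmetricSpace α₁ α₂)
    (hg : g ∈ symmetricSpace α₁ α₂) (hh : h ∈ symmetricSpace α₁ α₂) :
    twistedConv q f (g + h) = twistedConv q f g + twistedConv q f h := by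
  obtain ⟨M, hM⟩ := exists_norm_le_of_mem h₁ h₂ hg
  obtain ⟨M', hM'⟩ := exists_norm_le_of_mem h₁ h₂ hh
  funext x
  simp only [twistedConv, Pi.add_apply, mul_add]
  exact integral_add
    (integrable_twistedConv_integrand q (integrable_of_mem h₁ h₂ hf) (continuous_of_mem hg) hM x)
    (integrable_twistedConv_integrand q (integrable_of_mem h₁ h₂ hf) (continuous_of_mem hh) hM' x)

theorem weyl_add_left (q : ℝ) (hf : f ∈ symmetricSpace α₁ α₂)
    (hg : g ∈ symmetricSpace α₁ α₂) (hh : h ∈ symmetricSpace α₁ α₂) :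
    weyl q (f + g) h = weyl q f h + weyl q g h := by
  have hf' := symplecticFourier_mem h₁ h₂ hf
  have hg' := symplecticFourier_mem h₁ h₂ hg
  have hh' := symplecticFourier_mem h₁ h₂ hh
  rw [weyl, symplecticFourier_add (integrable_of_mem h₁ h₂ hf) (integrable_of_mem h₁ h₂ hg),
    twistedConv_add_left h₁ h₂ q hf' hg' hh', symplecticFourier_add
      (integrable_of_mem h₁ h₂ (twistedConv_mem h₁ h₂ q hf' hh'))
      (integrable_of_mem h₁ h₂ (twistedConv_mem h₁ h₂ q hg' hh'))]
  rfl

theorem weyl_add_right (q : ℝ) (hf : f ∈ symmetricSpace α₁ α₂)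
    (hg : g ∈ symmetricSpace α₁ α₂) (hh : h ∈ symmetricSpace α₁ α₂) :
    weyl q f (g + h) = weyl q f g + weyl q f h := by
  have hf' := symplecticFourier_mem h₁ h₂ hf
  have hg' := symplecticFourier_mem h₁ h₂ hg
  have hh' := symplecticFourier_mem h₁ h₂ hh
  rw [weyl, symplecticFourier_add (integrable_of_mem h₁ h₂ hg) (integrable_of_mem h₁ h₂ hh),
    twistedConv_add_right h₁ h₂ q hf' hg' hh', symplecticFourier_add
      (integrable_of_mem h₁ h₂ (twistedConv_mem h₁ h₂ q hf' hg'))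
      (integrable_of_mem h₁ h₂ (twistedConv_mem h₁ h₂ q hf' hh'))]
  rfl

omit h₁ h₂ in
theorem weyl_smul_left (q : ℝ) (c : ℂ) (f g : (Fin 2 → ℝ) → ℂ) :
    weyl q (c • f) g = c • weyl q f g := by
  simp only [weyl, symplecticFourier_smul, twistedConv_smul_left]

omit h₁ h₂ in
theorem weyl_smul_right (q : ℝ) (c : ℂ) (f g : (Fin 2 → ℝ) → ℂ) :
    weyl q f (c • g) = c • weyl q f g := by
  simp only [weyl, symplecticFourier_smul, twistedConv_smul_right]

/-- The two inner Fourier transforms cancel up to the same scalar `(2π)²` on both sides, leaving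
associativity of twisted convolution. -/
theorem weyl_assoc (q : ℝ) (hf : f ∈ symmetricSpace α₁ α₂)
    (hg : g ∈ symmetricSpace α₁ α₂) (hh : h ∈ symmetricSpace α₁ α₂) :
    weyl q (weyl q f g) h = weyl q f (weyl q g h) := by
  have hf' := symplecticFourier_mem h₁ h₂ hf
  have hg' := symplecticFourier_mem h₁ h₂ hg
  have hh' := symplecticFourier_mem h₁ h₂ hh
  obtain ⟨M, hM⟩ := exists_norm_le_of_mem h₁ h₂ hh'
  simp only [weyl]
  rw [symplecticFourier_symplecticFourier h₁ h₂ (twistedConv_mem h₁ h₂ q hf' hg'),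
    symplecticFourier_symplecticFourier h₁ h₂ (twistedConv_mem h₁ h₂ q hg' hh'),
    twistedConv_smul_left, twistedConv_smul_right,
    twistedConv_assoc q (integrable_of_mem h₁ h₂ hf') (integrable_of_mem h₁ h₂ hg')
      (continuous_of_mem hh') hM]

end symmetricSpace

end TwistedWeyl

namespace TwistedWeyl

/-! ### The inverse Laplace transform on a vertical strip -/

/-- `F` is holomorphic on `Γ + iℝ` and decays there at least quadratically in the imaginary
direction. -/
def StripDecay (Γ : Set ℝ) (F : ℂ → ℂ) : Prop :=
  DifferentiableOn ℂ F {z | z.re ∈ Γ} ∧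
    ∃ C : ℝ, ∀ z : ℂ, z.re ∈ Γ → (1 + |z.im|) ^ 2 * ‖F z‖ ≤ C

section StripDecay

variable {Γ : Set ℝ} {F : ℂ → ℂ} {c c' : ℝ}

theorem isOpen_re_preimage (hΓ : IsOpen Γ) : IsOpen {z : ℂ | z.re ∈ Γ} :=
  hΓ.preimage Complex.continuous_re

theorem integrable_inv_one_add_abs_sq : Integrable fun t : ℝ => ((1 + |t|) ^ 2)⁻¹ := by
  refine integrable_of_pow_mul_le (C := 1) ?_ fun t => ?_
  · refine (Continuous.inv₀ (by fun_prop) fun t => ?_).aestronglyMeasurable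
    positivity
  · rw [abs_of_nonneg (a := ((1 + |t|) ^ 2)⁻¹) (by positivity), mul_inv_cancel₀ (by positivity)]

theorem StripDecay.continuous_line (hΓ : IsOpen Γ) (hF : StripDecay Γ F) {z : ℂ} (hz : z.re ∈ Γ) :
    Continuous fun t : ℝ => F (z + t * Complex.I) := by
  refine continuous_iff_continuousAt.2 fun t => ?_
  have h : ContinuousAt F (z + t * Complex.I) := by
    refine (hF.1.differentiableAt ((isOpen_re_preimage hΓ).mem_nhds ?_)).continuousAt
    simpa using hz
  exact ContinuousAt.comp (f := fun t : ℝ => z + t * Complex.I) h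
    (by fun_prop : Continuous fun t : ℝ => z + t * Complex.I).continuousAt

/-- From `1 + |t| ≤ (1 + |Im z + t|)(1 + |Im z|)`. The base point is complex so that the line
integral can be differentiated holomorphically in it. -/
theorem StripDecay.exists_norm_line_le (hF : StripDecay Γ F) :
    ∃ C, 0 ≤ C ∧ ∀ z : ℂ, z.re ∈ Γ → ∀ t : ℝ,
      ‖F (z + t * Complex.I)‖ ≤ C * (1 + |z.im|) ^ 2 * ((1 + |t|) ^ 2)⁻¹ := by
  obtain ⟨-, C, hC⟩ := hF
  refine ⟨|C|, abs_nonneg C, fun z hz t => ?_⟩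
  have h := hC (z + t * Complex.I) (by simpa using hz)
  rw [← div_eq_mul_inv, le_div_iff₀ (by positivity)]
  have e1 : 1 + |t| ≤ (1 + |(z + t * Complex.I).im|) * (1 + |z.im|) := by
    have : (z + t * Complex.I).im = z.im + t := by simp
    rw [this]
    have h3 : |t| ≤ |z.im + t| + |z.im| := by
      simpa using abs_sub (z.im + t) z.im
    nlinarith [mul_nonneg (abs_nonneg (z.im + t)) (abs_nonneg z.im)]
  calc ‖F (z + t * Complex.I)‖ * (1 + |t|) ^ 2
      ≤ ‖F (z + t * Complex.I)‖ * ((1 + |(z + t * Complex.I).im|) * (1 + |z.im|)) ^ 2 := by gcongr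
    _ = ((1 + |(z + t * Complex.I).im|) ^ 2 * ‖F (z + t * Complex.I)‖) * (1 + |z.im|) ^ 2 := by ring
    _ ≤ |C| * (1 + |z.im|) ^ 2 := by gcongr; exact h.trans (le_abs_self C)

theorem StripDecay.integrable_line (hΓ : IsOpen Γ) (hF : StripDecay Γ F) (hc : c ∈ Γ) :
    Integrable fun t : ℝ => F (c + t * Complex.I) := by
  obtain ⟨C, -, hC⟩ := hF.exists_norm_line_le
  exact (integrable_inv_one_add_abs_sq.const_mul _).mono'
    (hF.continuous_line hΓ (z := c) (by simpa using hc)).aestronglyMeasurable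
    (.of_forall fun t => hC c (by simpa using hc) t)

theorem StripDecay.integrable_exp_mul_line (hΓ : IsOpen Γ) (hF : StripDecay Γ F) (hc : c ∈ Γ)
    (x : ℝ) : Integrable fun t : ℝ => Complex.exp (((c : ℂ) + (t : ℂ) * Complex.I) * (x : ℂ)) *
      F ((c : ℂ) + (t : ℂ) * Complex.I) := by
  refine (hF.integrable_line hΓ hc).bdd_mul (c := Real.exp (c * x)) ?_ (.of_forall fun t => ?_)
  · exact (by fun_prop : Continuous fun t : ℝ =>
      Complex.exp (((c : ℂ) + (t : ℂ) * Complex.I) * (x : ℂ))).aestronglyMeasurable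
  · rw [Complex.norm_exp]; simp

theorem invLaplace_eq (c : ℝ) (F : ℂ → ℂ) (x : ℝ) : invLaplace c F x =
    (2 * Real.pi : ℂ)⁻¹ * (Complex.exp (c * x) *
      ∫ t : ℝ, Complex.exp (Complex.I * x * t) * F (c + t * Complex.I)) := by
  rw [invLaplace, ← integral_const_mul (Complex.exp (c * x))]
  congr 1
  refine integral_congr_ae (.of_forall fun t => ?_)
  simp only
  rw [← mul_assoc, ← Complex.exp_add]
  congr 2
  ring

/-- As a function of a complex base point, the line integral is holomorphic on the strip and
invariant under imaginary translations, so its derivative vanishes and it is constant on the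
connected strip. -/
theorem StripDecay.invLaplace_congr (hΓ : IsOpen Γ) (hΓ' : Γ.OrdConnected) (hF : StripDecay Γ F)
    (hc : c ∈ Γ) (hc' : c' ∈ Γ) (x : ℝ) : invLaplace c F x = invLaplace c' F x := by
  set U : Set ℂ := {z | z.re ∈ Γ}
  have hU : IsOpen U := isOpen_re_preimage hΓ
  have hUc : IsPreconnected U :=
    (hΓ'.convex.linear_preimage Complex.reLm).isPreconnected
  set J : ℂ → ℂ := fun z => ∫ t : ℝ, Complex.exp ((z + t * Complex.I) * x) * F (z + t * Complex.I)
  obtain ⟨C, hC0, hC⟩ := hF.exists_norm_line_le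
  have hJ : ∀ z ∈ U, DifferentiableAt ℂ J z := fun z hz => by
    have hcont : Continuous fun v : ℂ => Real.exp (v.re * x) * (C * (1 + |v.im|) ^ 2) := by fun_prop
    refine differentiableAt_integral
      (Filter.inter_mem (setOf_lt_mem_nhds hcont z) (hU.mem_nhds hz)) (fun v hv => ?_)
      (fun t => ?_) (integrable_inv_one_add_abs_sq.const_mul _) (fun v hv t => ?_)
      (g := fun t => (Real.exp (z.re * x) * (C * (1 + |z.im|) ^ 2) + 1) * ((1 + |t|) ^ 2)⁻¹)
    · exact ((by fun_prop : Continuous fun t : ℝ =>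
        Complex.exp ((v + t * Complex.I) * x)).mul
        (hF.continuous_line hΓ hv.2)).aestronglyMeasurable
    · refine DifferentiableOn.mul (by fun_prop) (hF.1.comp (by fun_prop) fun v hv => ?_)
      have : v.re ∈ Γ := hv.2
      simpa using this
    · have e : ‖Complex.exp ((v + t * Complex.I) * x)‖ = Real.exp (v.re * x) := by
        rw [Complex.norm_exp]; simp
      have hv1 : Real.exp (v.re * x) * (C * (1 + |v.im|) ^ 2) < _ := hv.1
      rw [norm_mul, e]
      calc _ ≤ Real.exp (v.re * x) * (C * (1 + |v.im|) ^ 2 * ((1 + |t|) ^ 2)⁻¹) := by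
            gcongr; exact hC v hv.2 t
        _ = Real.exp (v.re * x) * (C * (1 + |v.im|) ^ 2) * ((1 + |t|) ^ 2)⁻¹ := by ring
        _ ≤ _ := by gcongr
  have hJ' : U.EqOn (fderiv ℂ J) 0 := fun z hz => by
    refine fderiv_eq_zero_of_span (hJ z hz) (S := {Complex.I}) ?_ ?_
    · rw [eq_top_iff]
      intro v _
      exact Submodule.mem_span_singleton.2 ⟨v / Complex.I, div_mul_cancel₀ v Complex.I_ne_zero⟩
    · rintro _ rfl
      refine .of_forall fun s => ?_
      have : ∀ t : ℝ, z + (s : ℂ) • Complex.I + t * Complex.I = z + (t + s : ℝ) * Complex.I :=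
        fun t => by push_cast; rw [smul_eq_mul]; ring
      simp only [J, this]
      exact integral_add_right_eq_self (fun t : ℝ =>
        Complex.exp ((z + t * Complex.I) * x) * F (z + t * Complex.I)) s
  have := hU.is_const_of_fderiv_eq_zero hUc (fun z hz => (hJ z hz).differentiableWithinAt) hJ'
    (x := c) (y := c') (by simpa [U] using hc) (by simpa [U] using hc')
  simp only [invLaplace]
  exact congrArg _ this

theorem StripDecay.exists_norm_invLaplace_le (hΓ : IsOpen Γ) (hF : StripDecay Γ F) (hc : c ∈ Γ) :
    ∃ C, ∀ x : ℝ, ‖invLaplace c F x‖ ≤ C * Real.exp (c * x) := by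
  refine ⟨‖(2 * Real.pi : ℂ)⁻¹‖ * ∫ t : ℝ, ‖F (c + t * Complex.I)‖, fun x => ?_⟩
  rw [invLaplace_eq, norm_mul, norm_mul, mul_assoc, mul_comm (∫ t : ℝ, _) (Real.exp _)]
  have e : ‖Complex.exp (c * x)‖ = Real.exp (c * x) := by
    rw [Complex.norm_exp]; simp
  rw [e]
  gcongr
  refine norm_integral_le_of_norm_le (hF.integrable_line hΓ hc).norm (.of_forall fun t => ?_)
  rw [norm_mul, norm_exp_I_mul_mul, one_mul]

theorem StripDecay.continuous_integral_line (hΓ : IsOpen Γ) (hF : StripDecay Γ F) (hc : c ∈ Γ) :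
    Continuous fun x : ℝ => ∫ t : ℝ, Complex.exp (Complex.I * x * t) * F (c + t * Complex.I) := by
  have hm := (hF.continuous_line hΓ (z := c) (by simpa using hc))
  refine continuous_of_dominated (fun x => ?_) (fun x => .of_forall fun t => ?_)
    (hF.integrable_line hΓ hc).norm (.of_forall fun t => by fun_prop)
  · exact ((by fun_prop : Continuous fun t : ℝ =>
      Complex.exp (Complex.I * x * t)).mul hm).aestronglyMeasurable
  · rw [norm_mul, norm_exp_I_mul_mul, one_mul]

/-- The Laplace transform inverts the inverse Laplace transform on the open strip. -/
theorem StripDecay.laplace_invLaplace (hΓ : IsOpen Γ) (hΓ' : Γ.OrdConnected) (hF : StripDecay Γ F)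
    (hc : c ∈ Γ) {z : ℂ} (hz : z.re ∈ Γ) :
    Integrable (fun s : ℝ => Complex.exp (-z * s) * invLaplace c F s) ∧
      laplace (invLaplace c F) z = F z := by
  have hfun : invLaplace c F = invLaplace z.re F :=
    funext fun x => hF.invLaplace_congr hΓ hΓ' hc hz x
  set h : ℝ → ℂ := fun x => ∫ t : ℝ, Complex.exp (Complex.I * x * t) * F (z.re + t * Complex.I)
  have hhc : Continuous h := hF.continuous_integral_line hΓ hz
  have hinv : ∀ s : ℝ, invLaplace z.re F s = (2 * Real.pi : ℂ)⁻¹ * (Complex.exp (z.re * s) * h s) :=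
    fun s => invLaplace_eq _ _ _
  have hpi : (2 * Real.pi : ℂ) ≠ 0 := by simp [Real.pi_ne_zero]
  -- Moving the line to `Re z - ε/2` for `s ≥ 0` and to `Re z + ε/2` for `s ≤ 0`, possible because
  -- `Γ` is open, gives decay `exp(-ε|s|/2)` at both ends.
  have hh : Integrable h := by
    obtain ⟨ε, hε, hball⟩ := Metric.isOpen_iff.1 hΓ _ hz
    have hp : z.re + ε / 2 ∈ Γ := hball (by simp [abs_of_pos hε, hε])
    have hm : z.re - ε / 2 ∈ Γ := hball (by simp [abs_of_pos hε, hε])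
    obtain ⟨C₁, hC₁⟩ := hF.exists_norm_invLaplace_le hΓ hp
    obtain ⟨C₂, hC₂⟩ := hF.exists_norm_invLaplace_le hΓ hm
    have hi := (integrable_exp_neg_rpow le_rfl (half_pos hε)).const_mul
      (2 * Real.pi * (max |C₁| |C₂|))
    refine hi.mono' hhc.aestronglyMeasurable (.of_forall fun s => ?_)
    have e : h s = 2 * Real.pi * (Complex.exp (-(z.re * s)) * invLaplace z.re F s) := by
      rw [hinv, Complex.exp_neg]
      have := Complex.exp_ne_zero (z.re * s)
      field_simp
    have e1 : ‖Complex.exp (-(z.re * s))‖ = Real.exp (-(z.re * s)) := by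
      rw [Complex.norm_exp]; simp
    have e2 : ‖(2 * Real.pi : ℂ)‖ = 2 * Real.pi := by
      simp [abs_of_pos Real.pi_pos]
    rw [e, norm_mul, e2, norm_mul, e1, mul_assoc (2 * Real.pi) (max |C₁| |C₂|), Real.rpow_one]
    refine mul_le_mul_of_nonneg_left ?_ (by positivity)
    rcases le_total 0 s with hs | hs
    · rw [hF.invLaplace_congr hΓ hΓ' hz hm, abs_of_nonneg hs]
      calc _ ≤ Real.exp (-(z.re * s)) * (max |C₁| |C₂| * Real.exp ((z.re - ε / 2) * s)) := by
            gcongr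
            refine (hC₂ s).trans ?_
            gcongr
            exact (le_abs_self _).trans (le_max_right _ _)
        _ = max |C₁| |C₂| * (Real.exp (-(z.re * s)) * Real.exp ((z.re - ε / 2) * s)) := by ring
        _ = _ := by rw [← Real.exp_add]; congr 2; ring
    · rw [hF.invLaplace_congr hΓ hΓ' hz hp, abs_of_nonpos hs]
      calc _ ≤ Real.exp (-(z.re * s)) * (max |C₁| |C₂| * Real.exp ((z.re + ε / 2) * s)) := by
            gcongr
            refine (hC₁ s).trans ?_
            gcongr
            exact (le_abs_self _).trans (le_max_left _ _)
        _ = max |C₁| |C₂| * (Real.exp (-(z.re * s)) * Real.exp ((z.re + ε / 2) * s)) := by ring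
        _ = _ := by rw [← Real.exp_add]; congr 2; ring
  have hker : ∀ s : ℝ, Complex.exp (-z * s) * invLaplace z.re F s =
      (2 * Real.pi : ℂ)⁻¹ * (Complex.exp (-(Complex.I * s * z.im)) * h s) := fun s => by
    rw [hinv, mul_left_comm, ← mul_assoc (Complex.exp _) (Complex.exp _), ← Complex.exp_add]
    congr 3
    linear_combination (s : ℂ) * Complex.re_add_im z
  rw [laplace, hfun]
  simp only [hker]
  constructor
  · refine (hh.bdd_mul (c := 1) ?_ (.of_forall fun s => ?_)).const_mul _
    · exact (by fun_prop : Continuous fun s : ℝ =>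
        Complex.exp (-(Complex.I * s * z.im))).aestronglyMeasurable
    · rw [Complex.norm_exp]; simp
  · rw [integral_const_mul, integral_exp_neg_mul_integral_exp_mul
      (g := fun t : ℝ => F (z.re + t * Complex.I))
      (hF.continuous_line hΓ (z := z.re) (by simpa using hz)) (hF.integrable_line hΓ hz) hh z.im,
      inv_mul_cancel_left₀ hpi, Complex.re_add_im]

end StripDecay

end TwistedWeyl

namespace TwistedWeyl

/-! ### The twisting map and its inverse -/

section twist

variable {q θ : ℝ}

theorem isOpen_strip (q : ℝ) : IsOpen (strip q) :=
  isOpen_lt (by fun_prop) continuous_const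

theorem abs_mul_re_lt (hq : q ≠ 0) {z : ℂ} (hz : z ∈ strip q) : |(q * z).re| < Real.pi / 2 := by
  have h : |z.re| < Real.pi / (2 * |q|) := hz
  rw [lt_div_iff₀ (by positivity)] at h
  rw [Complex.re_ofReal_mul, abs_mul]
  linarith

theorem twist_eq_sin (hq : q ≠ 0) (z : ℂ) : twist q θ z =
    Complex.exp (Complex.I * θ) * Complex.I / q * Complex.sin (q * z) := by
  rw [twist, if_neg hq, mul_assoc, mul_comm Complex.I (q * z), Complex.sinh_mul_I]
  ring

theorem twist_const_ne_zero (hq : q ≠ 0) : Complex.exp (Complex.I * θ) * Complex.I / q ≠ 0 := by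
  simp [hq]

/-- The map is a nonzero multiple of `sin(qz)` with `|Re(qz)| < π/2`. Of the solutions of `sin =
sin`, real parts leave only the trivial one. -/
theorem twist_injOn (hq : q ≠ 0) : Set.InjOn (twist q θ) (strip q) := by
  intro z hz w hw h
  rw [twist_eq_sin hq, twist_eq_sin hq] at h
  have hs := mul_left_cancel₀ (twist_const_ne_zero hq) h
  have hz' := abs_lt.1 (abs_mul_re_lt hq hz)
  have hw' := abs_lt.1 (abs_mul_re_lt hq hw)
  have hpi := Real.pi_pos
  obtain ⟨k, hk | hk⟩ := Complex.sin_eq_sin_iff.1 hs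
  · have hre := congrArg Complex.re hk
    rw [Complex.add_re] at hre
    have e : ((2 * k * Real.pi : ℂ)).re = 2 * k * Real.pi := by
      exact_mod_cast Complex.ofReal_re (2 * k * Real.pi)
    rw [e] at hre
    have h1 : (k : ℝ) < 1 := by nlinarith
    have h2 : (-1 : ℝ) < k := by nlinarith
    have hk0 : k = 0 := by
      have h1' : k < 1 := by exact_mod_cast h1
      have h2' : -1 < k := by exact_mod_cast h2
      omega
    rw [hk0] at hk
    have : (q : ℂ) ≠ 0 := by exact_mod_cast hq
    apply mul_left_cancel₀ this
    simpa using hk.symm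
  · exfalso
    have hre := congrArg Complex.re hk
    rw [Complex.sub_re] at hre
    have e : (((2 * k + 1) * Real.pi : ℂ)).re = (2 * k + 1) * Real.pi := by
      exact_mod_cast Complex.ofReal_re ((2 * k + 1) * Real.pi)
    rw [e] at hre
    have h1 : (k : ℝ) < 0 := by nlinarith
    have h2 : (-1 : ℝ) < k := by nlinarith
    have h1' : k < 0 := by exact_mod_cast h1
    have h2' : -1 < k := by exact_mod_cast h2
    omega

theorem cos_ne_zero_of_mem_strip (hq : q ≠ 0) {z : ℂ} (hz : z ∈ strip q) :
    Complex.cos (q * z) ≠ 0 := by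
  intro h
  obtain ⟨k, hk⟩ := Complex.cos_eq_zero_iff.1 h
  have hz' := abs_lt.1 (abs_mul_re_lt hq hz)
  have hpi := Real.pi_pos
  have hre := congrArg Complex.re hk
  have e : (((2 * k + 1) * Real.pi / 2 : ℂ)).re = (2 * k + 1) * Real.pi / 2 := by
    exact_mod_cast Complex.ofReal_re ((2 * k + 1) * Real.pi / 2)
  rw [e] at hre
  have h1 : (k : ℝ) < 0 := by nlinarith
  have h2 : (-1 : ℝ) < k := by nlinarith
  have h1' : k < 0 := by exact_mod_cast h1
  have h2' : -1 < k := by exact_mod_cast h2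
  omega

theorem hasStrictDerivAt_twist (hq : q ≠ 0) (z : ℂ) : HasStrictDerivAt (twist q θ)
    (Complex.exp (Complex.I * θ) * Complex.I / q * (Complex.cos (q * z) * q)) z := by
  rw [funext (twist_eq_sin hq)]
  have h : HasStrictDerivAt (fun z : ℂ => (q : ℂ) * z) q z := by
    simpa using (hasStrictDerivAt_id z).const_mul (q : ℂ)
  exact ((Complex.hasStrictDerivAt_sin _).comp z h).const_mul _

theorem continuous_twist (hq : q ≠ 0) : Continuous (twist q θ) :=
  continuous_iff_continuousAt.2 fun z => (hasStrictDerivAt_twist hq z).hasDerivAt.continuousAt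

theorem twistInv_twist (hq : q ≠ 0) {z : ℂ} (hz : z ∈ strip q) : twistInv q θ (twist q θ z) = z :=
  (twist_injOn hq).leftInvOn_invFunOn hz

theorem twistInv_mem {z : ℂ} (hz : z ∈ twist q θ '' strip q) : twistInv q θ z ∈ strip q :=
  Function.invFunOn_mem hz

theorem twist_twistInv {z : ℂ} (hz : z ∈ twist q θ '' strip q) : twist q θ (twistInv q θ z) = z :=
  Function.invFunOn_eq hz

/-- The derivative is a nonzero multiple of `cos(qz)`, which has no zero in the strip. Its
nonvanishing makes the map locally open, which gives the continuity of the inverse needed before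
differentiating it. -/
theorem differentiableAt_twistInv (hq : q ≠ 0) {z : ℂ} (hz : z ∈ twist q θ '' strip q) :
    DifferentiableAt ℂ (twistInv q θ) z := by
  obtain ⟨w, hw, rfl⟩ := hz
  have hd := hasStrictDerivAt_twist (θ := θ) hq w
  have hne : Complex.exp (Complex.I * θ) * Complex.I / q * (Complex.cos (q * w) * q) ≠ 0 :=
    mul_ne_zero (twist_const_ne_zero hq)
      (mul_ne_zero (cos_ne_zero_of_mem_strip hq hw) (by exact_mod_cast hq))
  have hmap : Filter.map (twist q θ) (nhds w) = nhds (twist q θ w) := hd.map_nhds_eq hne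
  have hstrip : ∀ᶠ v in nhds w, v ∈ strip q := (isOpen_strip q).mem_nhds hw
  have hcont : ContinuousAt (twistInv q θ) (twist q θ w) := by
    rw [ContinuousAt, twistInv_twist hq hw, ← hmap, Filter.tendsto_map'_iff]
    exact Filter.tendsto_id.congr' (hstrip.mono fun v hv => (twistInv_twist hq hv).symm)
  refine (HasDerivAt.of_local_left_inverse (f := twist q θ) hcont ?_ hne ?_).differentiableAt
  · rw [twistInv_twist hq hw]
    exact hd.hasDerivAt
  · rw [← hmap, Filter.eventually_map]
    exact hstrip.mono fun v hv => by rw [twistInv_twist hq hv]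

theorem norm_twist_le (hq : q ≠ 0) (z : ℂ) :
    ‖twist q θ z‖ ≤ |q|⁻¹ * Real.exp (|q| * |z.im|) := by
  have h1 : ‖Complex.exp (Complex.I * θ)‖ = 1 := by rw [Complex.norm_exp]; simp
  rw [twist, if_neg hq, norm_mul, norm_div, h1, Complex.norm_real, Real.norm_eq_abs, one_div]
  gcongr
  rw [Complex.sinh, norm_div, Complex.norm_ofNat, div_le_iff₀ two_pos]
  refine (norm_sub_le _ _).trans ?_
  rw [Complex.norm_exp, Complex.norm_exp, mul_two, ← abs_mul]
  have e : (Complex.I * q * z).re = -(q * z.im) := by simp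
  rw [Complex.neg_re, e, neg_neg]
  gcongr
  · exact neg_le_abs _
  · exact le_abs_self _

/-- The inverse of the twisting map grows at least logarithmically, and the weights with exponent
larger than one turn this into decay faster than any polynomial. -/
theorem exists_pow_mul_exp_twistInv_le (hq : q ≠ 0) {α : ℝ} (hα : α ∈ Set.Ioo (0 : ℝ) 1) {a : ℝ}
    (ha : 0 < a) (n : ℕ) : ∃ C, 0 < C ∧ ∀ z ∈ twist q θ '' strip q,
      (1 + |z.im|) ^ n * Real.exp (-a * |(twistInv q θ z).im| ^ (1 / α)) ≤ C := by
  obtain ⟨K, hK, hKw⟩ := exists_mul_le_rpow (holderConjugate_one_div hα) ha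
  -- The last factor is the Young remainder when `n|q||Im w|` is absorbed into `a|Im w|^(1/α)`.
  refine ⟨(1 + |q|⁻¹) ^ n * Real.exp (K * (n * |q|) ^ (1 / (1 - α))), by positivity,
    fun z hz => ?_⟩
  set w := twistInv q θ z
  have hw : twist q θ w = z := twist_twistInv hz
  have h1 : 1 + |z.im| ≤ (1 + |q|⁻¹) * Real.exp (|q| * |w.im|) := by
    have h2 : |z.im| ≤ |q|⁻¹ * Real.exp (|q| * |w.im|) :=
      (Complex.abs_im_le_norm z).trans (hw ▸ norm_twist_le hq w)
    have h3 : 1 ≤ Real.exp (|q| * |w.im|) := Real.one_le_exp (by positivity)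
    linarith
  calc _ ≤ ((1 + |q|⁻¹) * Real.exp (|q| * |w.im|)) ^ n * Real.exp (-a * |w.im| ^ (1 / α)) := by
        gcongr
    _ = (1 + |q|⁻¹) ^ n * Real.exp (n * (|q| * |w.im|) + -a * |w.im| ^ (1 / α)) := by
        rw [mul_pow, ← Real.exp_nat_mul, mul_assoc, ← Real.exp_add]
    _ ≤ _ := by
        refine mul_le_mul_of_nonneg_left (Real.exp_le_exp.2 ?_) (by positivity)
        have := hKw |w.im| (n * |q|) (abs_nonneg _) (by positivity)
        linarith

end twist

/-! ### The twisted space -/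

variable {α₁ α₂ : ℝ} {q θ : ℝ} {Γ : Set ℝ} {c : ℝ}

theorem IsSym.stripDecay (h₁ : α₁ ∈ Set.Ioo (0 : ℝ) 1) (h₂ : α₂ ∈ Set.Ioo (0 : ℝ) 1)
    (hq : q ≠ 0) (hΓ : ∀ z : ℂ, z.re ∈ Γ → z ∈ twist q θ '' strip q) {φ : (Fin 2 → ℂ) → ℂ}
    (hφ : IsSym α₁ α₂ φ) (x : ℝ) :
    StripDecay Γ fun z => laplace (fun s => φ (cvec ![x, s])) (twistInv q θ z) := by
  constructor
  · intro z hz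
    exact ((hφ.differentiable_laplace h₁ h₂ x _).comp z
      (differentiableAt_twistInv hq (hΓ z hz))).differentiableWithinAt
  · obtain ⟨a, C, ha, hC, h⟩ := hφ.exists_norm_laplace_le h₁ h₂ (Real.pi / (2 * |q|))
    obtain ⟨D, hD, hD'⟩ := exists_pow_mul_exp_twistInv_le (θ := θ) hq h₁ ha 2
    refine ⟨C * D, fun z hz => ?_⟩
    calc _ ≤ (1 + |z.im|) ^ 2 * (C * Real.exp (-a * |(twistInv q θ z).im| ^ (1 / α₁))) := by
          gcongr
          exact h _ (le_of_lt (twistInv_mem (hΓ z hz))) x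
      _ = C * ((1 + |z.im|) ^ 2 * Real.exp (-a * |(twistInv q θ z).im| ^ (1 / α₁))) := by ring
      _ ≤ _ := by gcongr; exact hD' z (hΓ z hz)

/-- The bilinear form `((t, y), x) ↦ -(t x₂ - y x₁) / 2π`. -/
def phase : ℝ × ℝ →L[ℝ] (Fin 2 → ℝ) →L[ℝ] ℝ :=
  (ContinuousLinearMap.fst ℝ ℝ ℝ).smulRight
      (-(2 * Real.pi)⁻¹ • (ContinuousLinearMap.proj 1 : (Fin 2 → ℝ) →L[ℝ] ℝ)) +
    (ContinuousLinearMap.snd ℝ ℝ ℝ).smulRight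
      ((2 * Real.pi)⁻¹ • (ContinuousLinearMap.proj 0 : (Fin 2 → ℝ) →L[ℝ] ℝ))

theorem phase_apply (p : ℝ × ℝ) (x : Fin 2 → ℝ) :
    phase p x = -((2 * Real.pi)⁻¹ * (p.1 * x 1 - p.2 * x 0)) := by
  simp [phase]; ring

/-- Inserting `IsSym.laplace_slice_eq` turns the function into `exp(c x₂)` times a two-dimensional
Fourier integral of a density with all moments finite, which gives joint smoothness in both
variables. -/
theorem IsSym.contDiff_invLaplace (h₁ : α₁ ∈ Set.Ioo (0 : ℝ) 1) (h₂ : α₂ ∈ Set.Ioo (0 : ℝ) 1)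
    (hq : q ≠ 0) (hΓ : ∀ z : ℂ, z.re ∈ Γ → z ∈ twist q θ '' strip q)
    (hc : c ∈ Γ) {φ : (Fin 2 → ℂ) → ℂ} (hφ : IsSym α₁ α₂ φ) :
    ContDiff ℝ ∞ fun x : Fin 2 → ℝ => invLaplace c
      (fun z => laplace (fun s => φ (cvec ![x 0, s])) (twistInv q θ z)) (x 1) := by
  have hψ := isSym_sfExt h₁ h₂ hφ
  set ψ := sfExt φ
  set w : ℝ → ℂ := fun t => twistInv q θ (c + t * Complex.I)
  have hline : ∀ t : ℝ, ((c : ℂ) + t * Complex.I) ∈ twist q θ '' strip q :=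
    fun t => hΓ _ (by simpa using hc)
  have hw : Continuous w := continuous_iff_continuousAt.2 fun t =>
    ContinuousAt.comp (f := fun t : ℝ => (c : ℂ) + t * Complex.I)
      (differentiableAt_twistInv hq (hline t)).continuousAt
      (by fun_prop : Continuous fun t : ℝ => (c : ℂ) + t * Complex.I).continuousAt
  set g : ℝ × ℝ → ℂ := fun p => ψ ![-Complex.I * w p.1, p.2]
  have hg : Continuous g := by
    refine hψ.1.continuous.comp (continuous_pi fun j => ?_)
    fin_cases j
    · exact (hw.comp continuous_fst).const_mul _
    · exact Complex.continuous_ofReal.comp continuous_snd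
  have hmom : ∀ n : ℕ, Integrable fun p => ‖p‖ ^ n * ‖g p‖ := fun n => by
    obtain ⟨a, C, ha, hC, h⟩ := hψ.exists_norm_slice_le h₂ (Real.pi / (2 * |q|))
    -- Two powers beyond the moment order make the bound integrable in `t`.
    obtain ⟨D, hD, hD'⟩ := exists_pow_mul_exp_twistInv_le (θ := θ) hq h₁ ha (n + 2)
    have hi := ((integrable_inv_one_add_abs_sq.const_mul D).mul_prod
      (integrable_pow_mul_exp_neg_rpow (holderConjugate_one_div h₂).lt.le ha n)).const_mul C
    refine hi.mono' ((continuous_norm.pow n).mul hg.norm).aestronglyMeasurable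
      (.of_forall fun p => ?_)
    rw [Real.norm_of_nonneg (by positivity)]
    have e1 : ‖p‖ ≤ (1 + |p.1|) * (1 + |p.2|) := by
      rw [Prod.norm_def, Real.norm_eq_abs, Real.norm_eq_abs]
      have := mul_nonneg (abs_nonneg p.1) (abs_nonneg p.2)
      exact max_le (by linarith [abs_nonneg p.2]) (by linarith [abs_nonneg p.1])
    have e2 : (1 + |p.1|) ^ n * Real.exp (-a * |(w p.1).im| ^ (1 / α₁)) ≤
        D * ((1 + |p.1|) ^ 2)⁻¹ := by
      rw [← div_eq_mul_inv, le_div_iff₀ (by positivity)]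
      have := hD' _ (hline p.1)
      rw [pow_add] at this
      have e3 : ((c : ℂ) + p.1 * Complex.I).im = p.1 := by simp
      rw [e3] at this
      exact (by ring : _ = _).trans_le this
    calc ‖p‖ ^ n * ‖g p‖ ≤ ((1 + |p.1|) * (1 + |p.2|)) ^ n * (C *
          (Real.exp (-a * |(w p.1).im| ^ (1 / α₁)) * Real.exp (-a * |p.2| ^ (1 / α₂)))) := by
          gcongr
          exact h _ (le_of_lt (twistInv_mem (hline p.1))) _
      _ = C * (((1 + |p.1|) ^ n * Real.exp (-a * |(w p.1).im| ^ (1 / α₁))) *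
          ((1 + |p.2|) ^ n * Real.exp (-a * |p.2| ^ (1 / α₂)))) := by
        rw [mul_pow]; ring
      _ ≤ _ := by gcongr
  have hgi : Integrable g := by
    have := hmom 0
    simp only [pow_zero, one_mul] at this
    exact (integrable_norm_iff hg.aestronglyMeasurable).1 this
  have hsmooth := VectorFourier.contDiff_fourierIntegral (μ := volume) phase (f := g) (N := ⊤)
    fun n _ => hmom n
  have heq : (fun x : Fin 2 → ℝ => invLaplace c
      (fun z => laplace (fun s => φ (cvec ![x 0, s])) (twistInv q θ z)) (x 1)) = fun x =>
      ((2 * Real.pi : ℂ)⁻¹ * (2 * Real.pi : ℂ)⁻¹) * (((Real.exp (c * x 1) : ℝ) : ℂ) *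
        VectorFourier.fourierIntegral Real.fourierChar volume phase.toLinearMap₁₂ g x) := by
    funext x
    have hpi : (2 * Real.pi : ℂ) ≠ 0 := by simp [Real.pi_ne_zero]
    have hker : ∀ p : ℝ × ℝ, Real.fourierChar (-(phase.toLinearMap₁₂ p x)) • g p =
        Complex.exp (Complex.I * x 1 * p.1) * (Complex.exp (-(Complex.I * p.2 * x 0)) * g p) :=
      fun p => by
      rw [Circle.smul_def, Real.fourierChar_apply, smul_eq_mul, ← mul_assoc, ← Complex.exp_add]
      congr 2
      have : phase.toLinearMap₁₂ p x = phase p x := rfl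
      rw [this, phase_apply]
      push_cast
      field_simp
      ring
    have hlap : ∀ t : ℝ, laplace (fun s => φ (cvec ![x 0, s])) (w t) = (2 * Real.pi : ℂ)⁻¹ *
        ∫ y : ℝ, Complex.exp (-(Complex.I * y * x 0)) * g (t, y) := fun t =>
      (eq_inv_mul_iff_mul_eq₀ hpi).2 (hφ.laplace_slice_eq h₁ h₂ (w t) (x 0))
    have hint : Integrable fun p : ℝ × ℝ =>
        Complex.exp (Complex.I * x 1 * p.1) * (Complex.exp (-(Complex.I * p.2 * x 0)) * g p) := by
      refine (hgi.bdd_mul (c := 1) ?_ (.of_forall fun p => ?_)).bdd_mul (c := 1) ?_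
        (.of_forall fun p => (norm_exp_I_mul_mul _ _).le)
      · exact (by fun_prop : Continuous fun p : ℝ × ℝ =>
          Complex.exp (-(Complex.I * p.2 * x 0))).aestronglyMeasurable
      · rw [Complex.norm_exp]; simp
      · exact (by fun_prop : Continuous fun p : ℝ × ℝ =>
          Complex.exp (Complex.I * x 1 * p.1)).aestronglyMeasurable
    rw [invLaplace_eq, VectorFourier.fourierIntegral]
    simp only [hker]
    rw [Measure.volume_eq_prod] at hint ⊢
    rw [integral_prod _ hint]
    simp only [integral_const_mul]
    have : ∀ t : ℝ, laplace (fun s => φ (cvec ![x 0, s])) (twistInv q θ (c + t * Complex.I)) =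
      (2 * Real.pi : ℂ)⁻¹ * ∫ y : ℝ, Complex.exp (-(Complex.I * y * x 0)) * g (t, y) := hlap
    simp only [this, mul_left_comm _ (2 * Real.pi : ℂ)⁻¹, integral_const_mul]
    push_cast
    ring
  rw [heq]
  refine contDiff_const.mul (ContDiff.mul ?_ hsmooth)
  exact Complex.ofRealCLM.contDiff.comp
    (Real.contDiff_exp.comp (by fun_prop : ContDiff ℝ ∞ fun x : Fin 2 → ℝ => c * x 1))

end TwistedWeyl

namespace TwistedWeyl

/-! ### The twisting operator on the symmetric space: independence of the line, smoothness,
linearity, injectivity -/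

section tau

variable {α₁ α₂ : ℝ} (h₁ : α₁ ∈ Set.Ioo (0 : ℝ) 1) (h₂ : α₂ ∈ Set.Ioo (0 : ℝ) 1)
  {q : ℝ} (hq : q ≠ 0) {k : Fin 2} {Γ : Set ℝ} (hΓ : IsAdmissible q (angle k) Γ) {c c' : ℝ}
  {f g : (Fin 2 → ℝ) → ℂ}

include h₁ h₂ in
theorem integrable_exp_mul_of_mem (hf : f ∈ symmetricSpace α₁ α₂) (w : ℂ) (x : ℝ) :
    Integrable fun s : ℝ => Complex.exp (-w * s) * f ![x, s] := by
  obtain ⟨φ, hφ, h⟩ := mem_symmetricSpace_iff.1 hf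
  simpa only [h] using hφ.integrable_exp_mul_slice h₁ h₂ w x

include h₁ h₂ hq hΓ

theorem stripDecay_of_mem (hf : f ∈ symmetricSpace α₁ α₂) (x : ℝ) :
    StripDecay Γ fun z => laplace (fun s => f ![x, s]) (twistInv q (angle k) z) := by
  obtain ⟨φ, hφ, h⟩ := mem_symmetricSpace_iff.1 hf
  simpa only [h] using hφ.stripDecay h₁ h₂ hq hΓ.2.2.2 x

theorem tau_congr (hf : f ∈ symmetricSpace α₁ α₂) (hc : c ∈ Γ) (hc' : c' ∈ Γ) :
    tau q k c f = tau q k c' f :=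
  funext fun x => (stripDecay_of_mem h₁ h₂ hq hΓ hf (x 0)).invLaplace_congr hΓ.2.1 hΓ.2.2.1 hc hc' _

theorem contDiff_tau (hf : f ∈ symmetricSpace α₁ α₂) (hc : c ∈ Γ) :
    ContDiff ℝ ∞ (tau q k c f) := by
  obtain ⟨φ, hφ, h⟩ := mem_symmetricSpace_iff.1 hf
  rw [funext h]
  exact hφ.contDiff_invLaplace h₁ h₂ hq hΓ.2.2.2 hc

theorem tau_add (hf : f ∈ symmetricSpace α₁ α₂) (hg : g ∈ symmetricSpace α₁ α₂) (hc : c ∈ Γ) :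
    tau q k c (f + g) = tau q k c f + tau q k c g := by
  funext x
  have hl : ∀ w, laplace (fun s => (f + g) ![x 0, s]) w =
      laplace (fun s => f ![x 0, s]) w + laplace (fun s => g ![x 0, s]) w := fun w => by
    simp only [laplace, Pi.add_apply, mul_add]
    exact integral_add (integrable_exp_mul_of_mem h₁ h₂ hf w _)
      (integrable_exp_mul_of_mem h₁ h₂ hg w _)
  simp only [tau, Pi.add_apply, invLaplace, ← mul_add]
  rw [← integral_add
    ((stripDecay_of_mem h₁ h₂ hq hΓ hf (x 0)).integrable_exp_mul_line hΓ.2.1 hc (x 1))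
    ((stripDecay_of_mem h₁ h₂ hq hΓ hg (x 0)).integrable_exp_mul_line hΓ.2.1 hc (x 1))]
  congr 2
  funext t
  rw [← mul_add]
  exact congrArg _ (hl _)

omit h₁ h₂ hq hΓ in
theorem tau_smul (r : ℝ) (f : (Fin 2 → ℝ) → ℂ) : tau q k c (r • f) = r • tau q k c f := by
  funext x
  simp only [tau, Pi.smul_apply, invLaplace, laplace, Complex.real_smul, mul_left_comm _ (r : ℂ),
    integral_const_mul]

theorem laplace_tau (hf : f ∈ symmetricSpace α₁ α₂) (hc : c ∈ Γ) (x : ℝ) {z : ℂ}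
    (hz : z ∈ strip q) (hzΓ : (twist q (angle k) z).re ∈ Γ) :
    Integrable (fun s : ℝ => Complex.exp (-(twist q (angle k) z) * s) * tau q k c f ![x, s]) ∧
      laplace (fun s => f ![x, s]) z =
        laplace (fun s => tau q k c f ![x, s]) (twist q (angle k) z) := by
  have h := (stripDecay_of_mem h₁ h₂ hq hΓ hf x).laplace_invLaplace hΓ.2.1 hΓ.2.2.1 hc hzΓ
  simp only [twistInv_twist hq hz] at h
  exact ⟨h.1, h.2.symm⟩

/-- The partial Laplace transform vanishes on a nonempty open set, hence everywhere since it is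
entire. This reaches the imaginary axis, which need not lie in that open set, and Fourier inversion
applies there. -/
theorem eq_zero_of_tau_eq_zero (hf : f ∈ symmetricSpace α₁ α₂) (hc : c ∈ Γ)
    (h0 : tau q k c f = 0) : f = 0 := by
  obtain ⟨φ, hφ, h⟩ := mem_symmetricSpace_iff.1 hf
  obtain ⟨w, hw, hwc⟩ := hΓ.2.2.2 c (by simpa using hc)
  have hopen : IsOpen {z | z ∈ strip q ∧ (twist q (angle k) z).re ∈ Γ} :=
    (isOpen_strip q).inter (hΓ.2.1.preimage (Complex.continuous_re.comp (continuous_twist hq)))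
  have hzero : ∀ x, (fun z => laplace (fun s => φ (cvec ![x, s])) z) = fun _ => 0 := fun x => by
    refine AnalyticOnNhd.eq_of_eventuallyEq (𝕜 := ℂ) (z₀ := w)
      (fun z _ => (hφ.differentiable_laplace h₁ h₂ x).analyticAt z) (fun z _ => analyticAt_const) ?_
    filter_upwards [hopen.mem_nhds ⟨hw, by rw [hwc]; simpa using hc⟩] with z hz
    have := (laplace_tau h₁ h₂ hq hΓ hf hc x hz.1 hz.2).2
    simpa [h0, laplace, h] using this
  funext x
  have hx : x = ![x 0, x 1] := by ext j; fin_cases j <;> rfl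
  have key := hφ.integral_laplace_eq h₁ h₂ (x 0) (x 1)
  simp only [congrFun (hzero _) _, mul_zero, integral_zero] at key
  rw [h, hx]
  simpa [Real.pi_ne_zero] using key.symm

end tau

end TwistedWeyl

end

/-! ### Transport of the Weyl product to the range of the twisting operator -/

open TwistedWeyl in
theorem mainTheorem1 (α₁ α₂ : ℝ) (h₁ : α₁ ∈ Set.Ioo (0 : ℝ) 1) (h₂ : α₂ ∈ Set.Ioo (0 : ℝ) 1)
    (h₁₂ : 1 ≤ α₁ + α₂) (q : ℝ) (hq : q ≠ 0) (k : Fin 2)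
    (Γ : Set ℝ) (hΓ : IsAdmissible q (angle k) Γ) :
    ∃ (E : Submodule ℝ ((Fin 2 → ℝ) → ℂ))
      (T : E ≃ₗ[ℝ] symmetricSpace α₁ α₂)
      (star : E →ₗ[ℝ] E →ₗ[ℝ] E),
      -- `E` is the range of `τ` in the smooth functions, and `T` is the inverse of `τ`
      (∀ c ∈ Γ, (E : Set ((Fin 2 → ℝ) → ℂ)) =
        tau q k c '' (symmetricSpace α₁ α₂ : Set ((Fin 2 → ℝ) → ℂ))) ∧
      (∀ u : E, ContDiff ℝ ∞ (u : (Fin 2 → ℝ) → ℂ)) ∧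
      (∀ c ∈ Γ, ∀ u : E, tau q k c (T u : (Fin 2 → ℝ) → ℂ) = (u : (Fin 2 → ℝ) → ℂ)) ∧
      -- `T` is given by `L ∘ T = φ^* ∘ L` in the second variable
      (∀ (u : E) (x₁ : ℝ), ∀ z ∈ strip q, (twist q (angle k) z).re ∈ Γ →
        MeasureTheory.Integrable (fun s : ℝ =>
          Complex.exp (-(twist q (angle k) z) * (s : ℂ)) *
            (u : (Fin 2 → ℝ) → ℂ) ![x₁, s]) ∧
        laplace (fun s => (T u : (Fin 2 → ℝ) → ℂ) ![x₁, s]) z =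
          laplace (fun s => (u : (Fin 2 → ℝ) → ℂ) ![x₁, s]) (twist q (angle k) z)) ∧
      -- `star` is the transported Weyl product
      (∀ u v : E, (T (star u v) : (Fin 2 → ℝ) → ℂ) =
        weyl q (T u : (Fin 2 → ℝ) → ℂ) (T v : (Fin 2 → ℝ) → ℂ)) ∧
      (∀ c ∈ Γ, ∀ u v : E, (star u v : (Fin 2 → ℝ) → ℂ) =
        tau q k c (weyl q (T u : (Fin 2 → ℝ) → ℂ) (T v : (Fin 2 → ℝ) → ℂ))) ∧
      -- and it is associative
      (∀ u v w : E, star (star u v) w = star u (star v w)) := by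
  obtain ⟨c, hc⟩ := hΓ.1
  let τ : symmetricSpace α₁ α₂ →ₗ[ℝ] ((Fin 2 → ℝ) → ℂ) :=
    { toFun := fun f => tau q k c f
      map_add' := fun f g => tau_add h₁ h₂ hq hΓ f.2 g.2 hc
      map_smul' := fun r f => tau_smul r f }
  have hτ : Function.Injective τ :=
    (injective_iff_map_eq_zero τ).2 fun f hf =>
      Subtype.ext (eq_zero_of_tau_eq_zero h₁ h₂ hq hΓ f.2 hc hf)
  let T : LinearMap.range τ ≃ₗ[ℝ] symmetricSpace α₁ α₂ := (LinearEquiv.ofInjective τ hτ).symm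
  have hT : ∀ u, tau q k c (T u) = u := fun u =>
    congrArg Subtype.val ((LinearEquiv.ofInjective τ hτ).apply_symm_apply u)
  have hT' : ∀ d ∈ Γ, ∀ u, tau q k d (T u) = u := fun d hd u =>
    (tau_congr h₁ h₂ hq hΓ (T u).2 hd hc).trans (hT u)
  let W : symmetricSpace α₁ α₂ →ₗ[ℝ] symmetricSpace α₁ α₂ →ₗ[ℝ] symmetricSpace α₁ α₂ :=
    LinearMap.mk₂ ℝ (fun f g => ⟨weyl q f g, weyl_mem h₁ h₂ q f.2 g.2⟩)
      (fun f f' g => Subtype.ext (weyl_add_left h₁ h₂ q f.2 f'.2 g.2))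
      (fun r f g => Subtype.ext (weyl_smul_left q (r : ℂ) f g))
      (fun f g g' => Subtype.ext (weyl_add_right h₁ h₂ q f.2 g.2 g'.2))
      (fun r f g => Subtype.ext (weyl_smul_right q (r : ℂ) f g))
  -- Conjugating the Weyl product by `T` makes `T` multiplicative, so associativity can be checked
  -- after applying the injective map `T`.
  let star : LinearMap.range τ →ₗ[ℝ] LinearMap.range τ →ₗ[ℝ] LinearMap.range τ :=
    (W.compl₁₂ T.toLinearMap T.toLinearMap).compr₂ T.symm.toLinearMap
  have hstar : ∀ u v, T (star u v) = W (T u) (T v) := fun u v => T.apply_symm_apply _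
  refine ⟨LinearMap.range τ, T, star, fun d hd => ?_, fun u => ?_, hT', fun u x z hz hzΓ => ?_,
    fun u v => congrArg Subtype.val (hstar u v), fun d hd u v => ?_, fun u v w => ?_⟩
  · ext u
    constructor
    · rintro ⟨f, rfl⟩
      exact ⟨f, f.2, tau_congr h₁ h₂ hq hΓ f.2 hd hc⟩
    · rintro ⟨f, hf, rfl⟩
      exact ⟨⟨f, hf⟩, tau_congr h₁ h₂ hq hΓ hf hc hd⟩
  · rw [← hT u]
    exact contDiff_tau h₁ h₂ hq hΓ (T u).2 hc
  · have := laplace_tau h₁ h₂ hq hΓ (T u).2 hc x hz hzΓ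
    rwa [hT u] at this
  · rw [← hT' d hd (star u v)]
    exact congrArg (fun f : symmetricSpace α₁ α₂ => tau q k d f) (hstar u v)
  · apply T.injective
    rw [hstar, hstar, hstar, hstar]
    exact Subtype.ext (weyl_assoc h₁ h₂ q (T u).2 (T v).2 (T w).2)
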